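/- **Setting.** Let $J:\mathbb R^M\to\mathbb R$ be twice differentiable with $0<\nu I\le\nabla^2J(w)\le\delta I$ for all $w$ (so $\nu\le\delta$), let $w^o$ be its minimizer, and $H=\nabla^2J(w^o)$. Consider the asynchronous stochastic-gradient algorithm $$\boldsymbol w_i=\boldsymbol w_{i-1}-\boldsymbol\mu(i)\,\widehat{\nabla J}_i(\boldsymbol w_{i-1}),\qquad i\ge 0,$$ with $\mathbb E\|\boldsymbol w_{-1}\|^2<\infty$. Put $\widetilde{\boldsymbol w}_i=w^o-\boldsymbol w_i$, $\boldsymbol s_i(w)=\widehat{\nabla J}_i(w)-\nabla J(w)$, $\mathcal F_{i-1}=\sigma(\boldsymbol w_{-1},\dots,\boldsymbol w_{i-1})$ and $R_{s,i}(w)=\mathbb E[\boldsymbol s_i(w)\boldsymbol s_i(w)^{\mathsf T}\mid\mathcal F_{i-1}]$. Assume: * (gradient noise) almost surely, $\mathbb E[\boldsymbol s_i(\boldsymbol w_{i-1})\mid\mathcal F_{i-1}]=0$, $\mathbb E[\|\boldsymbol s_i(\boldsymbol w_{i-1})\|^2\mid\mathcal F_{i-1}]\le\beta^2\|\widetilde{\boldsymbol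 w}_{i-1}\|^2+\sigma_s^2$, and $R_{s,i}(w^o)\to R_s$ as $i\to\infty$, where $R_s$ is a constant matrix; * (step-sizes) the $\boldsymbol\mu(i)$ are independent, take values in $[0,\mu_{\rm ub}]$, have mean $\bar\mu>0$ and variance $\sigma_\mu^2$ for every $i$, and each $\boldsymbol\mu(i)$ is independent of the iterates $\boldsymbol w_j$, $j\le i-1$, and of the approximate gradients $\widehat{\nabla J}_j(\boldsymbol w_{j-1})$, $j\le i$; * (smoothness) for some $r>0$, $\tau,\tau_2\ge0$, $1\le\kappa\le2$ and all $\|\delta w\|\le r$: $\|\nabla^2J(w^o+\delta w)-H\|\le\tau\|\delta w\|$ and $\|R_{s,i}(w^o+\delta w)-R_{s,i}(w^o)\|\le\tau_2\|\delta w\|^\kappa$ almost surely, the latter also for $\mathcal F_{i-1}$-measurable $\delta w$ (wherever $R_{s,i}(w^o+\delta w)$ is defined). Let $\mu_x=\bar\mu+\sigma_\mu^2/\bar\mu$ and $\mu_o=2\nu/(\delta^2+\beta^2)$. **Convergence rate.** If $\mu_x<\mu_o$, then for all $i\ge0$ $$\mathbb E\|\widetilde{\boldsymbol w}_i\|^2\le\alpha\,\mathbb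 E\|\widetilde{\boldsymbol w}_{i-1}\|^2+(\bar\mu^2+\sigma_\mu^2)\sigma_s^2,$$ with all these expectations finite, where $\alpha=1-2\nu\bar\mu+(\delta^2+\beta^2)(\bar\mu^2+\sigma_\mu^2)$ satisfies $0\le\alpha<1$ and $$\alpha=1-2\nu\bar\mu+O(\mu_x^2).$$ **Performance.** Assume in addition that either $\nabla^2J$ is constant, or the following fourth-order moment conditions hold for some constants $\beta_4,\sigma_4,\rho$ and all $i$: $\mathbb E[\|\boldsymbol s_i(\boldsymbol w_{i-1})\|^4\mid\mathcal F_{i-1}]\le\beta_4^4\|\widetilde{\boldsymbol w}_{i-1}\|^4+\sigma_4^4$ almost surely and $\mathbb E\,\boldsymbol\mu(i)^4\le\rho\,\bar\mu\,\mu_x^2$ (the latter holds whenever $\mu_{\rm ub}^2\le\rho\,\mu_x$). Then, for all sufficiently small $\mu_x$, $$\mathrm{MSD}=\frac{\mu_x}{2}\,\mathrm{Tr}(H^{-1}R_s)+O(\mu_x^{3/2}),\qquad \mathrm{ER}=\frac{\mu_x}{4}\,\mathrm{Tr}(R_s)+O(\mu_x^{3/2}),$$ where MSD stands for both $\limsup_{i\to\infty}$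 and $\liminf_{i\to\infty}$ of $\mathbb E\|\widetilde{\boldsymbol w}_i\|^2$, and ER for both $\limsup$ and $\liminf$ of $\mathbb E\{J(\boldsymbol w_{i-1})-J(w^o)\}$ (hence for the limits when these exist). The constants in the $O(\cdot)$ terms and the threshold on $\mu_x$ depend only on $J$, $w^o$, $\nu,\delta,\beta,\sigma_s,\tau,\tau_2,\kappa,r,\beta_4,\sigma_4,\rho$ and $R_s$; they do not depend on the step-size process, the initial condition, or the probability space. -/

import Mathlib

open MeasureTheory ProbabilityTheory Filter Topology
open scoped ENNReal

noncomputable section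

/-- The Hessian matrix of `J` at `w`: the Jacobian matrix of the gradient of `J`. -/
def hessianMatrix {M : ℕ} (J : EuclideanSpace ℝ (Fin M) → ℝ) (w : EuclideanSpace ℝ (Fin M)) :
    Matrix (Fin M) (Fin M) ℝ :=
  Matrix.of fun m n => (fderiv ℝ (gradient J) w (EuclideanSpace.single n 1)) m

/-- `J` is twice differentiable with `0 < ν I ≤ ∇² J(w) ≤ δ I` for all `w`, and `wo` is its
global minimizer. -/
structure CostConditions {M : ℕ} (J : EuclideanSpace ℝ (Fin M) → ℝ)
    (wo : EuclideanSpace ℝ (Fin M)) (ν δ : ℝ) : Prop where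
  differentiable : Differentiable ℝ J
  differentiable_gradient : Differentiable ℝ (gradient J)
  pos : 0 < ν
  le : ν ≤ δ
  lower : ∀ w, (hessianMatrix J w - ν • (1 : Matrix (Fin M) (Fin M) ℝ)).PosSemidef
  upper : ∀ w, (δ • (1 : Matrix (Fin M) (Fin M) ℝ) - hessianMatrix J w).PosSemidef
  minimizer : ∀ w, J wo ≤ J w

/-- The data of an asynchronous stochastic-gradient algorithm on `ℝ^M`: a random initial point,
random step-sizes `step i` and random approximate gradient maps `ghat i`, for `i = 0, 1, 2, …`. -/
structure AsyncSGD (Ω : Type*) [MeasurableSpace Ω] (M : ℕ) where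
  init : Ω → EuclideanSpace ℝ (Fin M)
  step : ℕ → Ω → ℝ
  ghat : ℕ → EuclideanSpace ℝ (Fin M) → Ω → EuclideanSpace ℝ (Fin M)
  measurable_init : Measurable init
  measurable_step : ∀ i, Measurable (step i)
  measurable_ghat : ∀ i, Measurable fun p : EuclideanSpace ℝ (Fin M) × Ω => ghat i p.1 p.2

namespace AsyncSGD

variable {Ω : Type*} [MeasurableSpace Ω] {M : ℕ}

/-- The iterates, with the index shifted by one: `A.iter i` is the point `w_{i-1}` at which the
`i`-th approximate gradient is evaluated, so that
`w_i = w_{i-1} - μ(i) • ghat_i (w_{i-1})` for `i ≥ 0`. -/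
def iter (A : AsyncSGD Ω M) : ℕ → Ω → EuclideanSpace ℝ (Fin M)
  | 0 => A.init
  | i + 1 => fun ω => iter A i ω - A.step i ω • A.ghat i (iter A i ω) ω

/-- The error vector `wo - w_{i-1}`. -/
def err (A : AsyncSGD Ω M) (wo : EuclideanSpace ℝ (Fin M)) (i : ℕ) (ω : Ω) :
    EuclideanSpace ℝ (Fin M) :=
  wo - A.iter i ω

/-- The σ-algebra `F_{i-1}` generated by `w_{-1}, w_0, …, w_{i-1}`. -/
abbrev past (A : AsyncSGD Ω M) (i : ℕ) : MeasurableSpace Ω :=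
  ⨆ j : Fin (i + 1), MeasurableSpace.comap (A.iter j) inferInstance

/-- The gradient noise `s_i(w)`, a random field in `w`. -/
def noise (A : AsyncSGD Ω M) (J : EuclideanSpace ℝ (Fin M) → ℝ) (i : ℕ)
    (w : EuclideanSpace ℝ (Fin M)) (ω : Ω) : EuclideanSpace ℝ (Fin M) :=
  A.ghat i w ω - gradient J w

/-- The conditional second-order moment `R_{s,i}(W) = E[s_i(W) s_i(W)ᵀ | F_{i-1}]` of the gradient
noise at a (possibly random) point `W`. -/
def condCov (A : AsyncSGD Ω M) (P : Measure Ω) (J : EuclideanSpace ℝ (Fin M) → ℝ) (i : ℕ)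
    (W : Ω → EuclideanSpace ℝ (Fin M)) (ω : Ω) : Matrix (Fin M) (Fin M) ℝ :=
  Matrix.of fun m n =>
    (P[fun ω' => A.noise J i (W ω') ω' m * A.noise J i (W ω') ω' n | A.past i]) ω

/-- Conditions on the gradient noise: conditionally on the past it has zero mean at the iterate,
second moment at most `β² ‖err‖² + σs²`, and its conditional covariance matrix at `wo` tends almost
surely to the constant matrix `Rs`. The conditional second moment is the `[0, ∞]`-valued one, so
that the bound includes the finiteness of the moment. -/
structure NoiseConditions (A : AsyncSGD Ω M) (P : Measure Ω)
    (J : EuclideanSpace ℝ (Fin M) → ℝ) (wo : EuclideanSpace ℝ (Fin M)) (β σs : ℝ)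
    (Rs : Matrix (Fin M) (Fin M) ℝ) : Prop where
  mean_zero : ∀ i, P[fun ω => A.noise J i (A.iter i ω) ω | A.past i] =ᵐ[P] 0
  second_moment : ∀ i, ∀ᵐ ω ∂P,
    condLExp (A.past i) P (fun ω' => ‖A.noise J i (A.iter i ω') ω'‖ₑ ^ 2) ω
      ≤ ENNReal.ofReal (β ^ 2 * ‖A.err wo i ω‖ ^ 2 + σs ^ 2)
  memLp_minimizer : ∀ i, MemLp (A.noise J i wo) 2 P
  tendsto_cov : ∀ᵐ ω ∂P, Tendsto (fun i => A.condCov P J i (fun _ => wo) ω) atTop (𝓝 Rs)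

/-- Conditions on the step-size process: independent random variables with values in `[0, μub]`,
with mean `μbar > 0` and variance `σμ²` that do not depend on `i`; and each `step i` is
independent of the iterates and of the approximate gradients that the algorithm has used up to (and
including) the `i`-th update. -/
structure StepConditions (A : AsyncSGD Ω M) (P : Measure Ω) (μub μbar σμ : ℝ) : Prop where
  ub_pos : 0 < μub
  mem_Icc : ∀ i, ∀ᵐ ω ∂P, A.step i ω ∈ Set.Icc 0 μub
  iIndep : iIndepFun A.step P
  mean_pos : 0 < μbar
  mean : ∀ i, ∫ ω, A.step i ω ∂P = μbar
  variance : ∀ i, ∫ ω, (A.step i ω - μbar) ^ 2 ∂P = σμ ^ 2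
  indep : ∀ i, Indep (MeasurableSpace.comap (A.step i) inferInstance)
    (A.past i ⊔ ⨆ j : Fin (i + 1),
      MeasurableSpace.comap (fun ω => A.ghat j (A.iter j ω) ω) inferInstance) P

/-- The asymptotic mean-square deviation, `limsup E ‖err‖²`. -/
def msdSup (A : AsyncSGD Ω M) (P : Measure Ω) (wo : EuclideanSpace ℝ (Fin M)) : ℝ :=
  limsup (fun i => ∫ ω, ‖A.err wo i ω‖ ^ 2 ∂P) atTop

/-- The corresponding lower limit; the limit exists exactly when the two agree. -/
def msdInf (A : AsyncSGD Ω M) (P : Measure Ω) (wo : EuclideanSpace ℝ (Fin M)) : ℝ :=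
  liminf (fun i => ∫ ω, ‖A.err wo i ω‖ ^ 2 ∂P) atTop

/-- The asymptotic excess risk, `limsup E {J(w_{i-1}) - J(wo)}`. -/
def erSup (A : AsyncSGD Ω M) (P : Measure Ω) (J : EuclideanSpace ℝ (Fin M) → ℝ)
    (wo : EuclideanSpace ℝ (Fin M)) : ℝ :=
  limsup (fun i => ∫ ω, (J (A.iter i ω) - J wo) ∂P) atTop

/-- The corresponding lower limit. -/
def erInf (A : AsyncSGD Ω M) (P : Measure Ω) (J : EuclideanSpace ℝ (Fin M) → ℝ)
    (wo : EuclideanSpace ℝ (Fin M)) : ℝ :=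
  liminf (fun i => ∫ ω, (J (A.iter i ω) - J wo) ∂P) atTop

end AsyncSGD

/-- The asynchronous step-size parameter `μ_x = μbar + σμ² / μbar`. -/
def muX (μbar σμ : ℝ) : ℝ := μbar + σμ ^ 2 / μbar

/-- The convergence rate `α = 1 - 2 ν μbar + (δ² + β²)(μbar² + σμ²)`. -/
def alphaAsyn (ν δ β μbar σμ : ℝ) : ℝ :=
  1 - 2 * ν * μbar + (δ ^ 2 + β ^ 2) * (μbar ^ 2 + σμ ^ 2)

namespace AsyncSGD

variable {Ω : Type*} [MeasurableSpace Ω] {M : ℕ}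

/-- Fourth-order moment conditions on the gradient noise and on the step-sizes. -/
structure FourthMomentConditions (A : AsyncSGD Ω M) (P : Measure Ω)
    (J : EuclideanSpace ℝ (Fin M) → ℝ) (wo : EuclideanSpace ℝ (Fin M))
    (β₄ σ₄ ρ μbar σμ : ℝ) : Prop where
  noise_le : ∀ i, ∀ᵐ ω ∂P,
    condLExp (A.past i) P (fun ω' => ‖A.noise J i (A.iter i ω') ω'‖ₑ ^ 4) ω
      ≤ ENNReal.ofReal (β₄ ^ 4 * ‖A.err wo i ω‖ ^ 4 + σ₄ ^ 4)
  step_le : ∀ i, ∫ ω, A.step i ω ^ 4 ∂P ≤ ρ * μbar * muX μbar σμ ^ 2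

end AsyncSGD

section Smoothness

open scoped Matrix.Norms.L2Operator

/-- The Hessian matrix of `J` is Lipschitz at `wo` (in the spectral norm) on the ball of
radius `r`. -/
def HessianLipschitzAt {M : ℕ} (J : EuclideanSpace ℝ (Fin M) → ℝ)
    (wo : EuclideanSpace ℝ (Fin M)) (τ r : ℝ) : Prop :=
  ∀ dw : EuclideanSpace ℝ (Fin M), ‖dw‖ ≤ r →
    ‖hessianMatrix J (wo + dw) - hessianMatrix J wo‖ ≤ τ * ‖dw‖

/-- The conditional noise covariance satisfies, in the spectral norm and almost surely,
`‖R_{s,i}(wo + dw) - R_{s,i}(wo)‖ ≤ τ₂ ‖dw‖^κ` for perturbations of size at most `r`. Since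
`R_{s,i}` is evaluated at the random iterates, `dw` may depend on the past; conditional second
moments are compared where they are defined, that is where the noise is square-integrable. -/
def AsyncSGD.CovLipschitzAt {Ω : Type*} [MeasurableSpace Ω] {M : ℕ} (A : AsyncSGD Ω M)
    (P : Measure Ω) (J : EuclideanSpace ℝ (Fin M) → ℝ) (wo : EuclideanSpace ℝ (Fin M))
    (τ₂ κ r : ℝ) : Prop :=
  ∀ (i : ℕ) (dw : Ω → EuclideanSpace ℝ (Fin M)), Measurable[A.past i] dw →
    (∀ ω, ‖dw ω‖ ≤ r) → MemLp (fun ω => A.noise J i (wo + dw ω) ω) 2 P →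
    ∀ᵐ ω ∂P, ‖A.condCov P J i (fun ω' => wo + dw ω') ω - A.condCov P J i (fun _ => wo) ω‖
      ≤ τ₂ * ‖dw ω‖ ^ κ

end Smoothness

end

set_option linter.unusedSectionVars false

open scoped RealInnerProductSpace

/-! The error obeys `e⁺ = e + μ (∇J(w) + s)`, where `μ` is independent of everything else in the
step and `s` has zero conditional mean. Expanding the square, `μ` factors out of each expectation
and `s` leaves the cross term. Since `E μ² = μbar * muX`, every change in the second moment carries
a factor `μbar`. Strong monotonicity and the Lipschitz bound of `∇J` then give the rate `alphaAsyn`,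
and `E‖e‖² = O(muX)` eventually.

For the performance, write `t² = muX` and project the recursion on a unit eigenvector `u` of the
Hessian `H` at the minimizer, with eigenvalue `lam` (`integral_inner_err_sq_succ`). The result is a
scalar contraction with rate `2 lam μbar` and driving term `μbar t² uᵀ Rs u`, whose fixed point is
`t² uᵀ Rs u / (2 lam)`. All other terms are `μbar * O(t³)`, so dividing by the rate cancels `μbar`
and leaves `O(t³) = O(muX ^ (3/2))`. Summing over an eigenbasis with weights `1` and `lam / 2`
produces `Tr(H⁻¹ Rs)` and `Tr Rs`.

Two perturbations need work. The linearization error contributes `E min(‖e‖², ‖e‖³)`, which should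
be controlled by fourth moments, but the initial error has only two. Every moment recursion
therefore holds on an arbitrary event of the past: on the event that the initial error is moderate
the fourth-order recursion applies, while the complementary event has probability at most `t`, and
the second-order recursion there yields `t² * t` (`eventually_integral_min_err_le`).

The noise term must be replaced by `uᵀ Rs u` up to `O(t)`
(`eventually_abs_integral_inner_noise_sq_sub_le`). Near the minimizer the covariance is compared
with its value at the minimizer, which converges in mean by dominated convergence; far iterates are
handled by Markov's inequality. -/

theorem toEuclideanCLM_hessianMatrix {M : ℕ} (J : EuclideanSpace ℝ (Fin M) → ℝ)
    (w : EuclideanSpace ℝ (Fin M)) :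
    Matrix.toEuclideanCLM (𝕜 := ℝ) (hessianMatrix J w) = fderiv ℝ (gradient J) w := by
  apply ContinuousLinearMap.coe_injective
  apply (EuclideanSpace.basisFun (Fin M) ℝ).toBasis.ext
  intro n
  ext m
  simp [hessianMatrix, Matrix.mulVec_single]

/-! ### Convexity, smoothness and Taylor remainders of the cost. -/

namespace CostConditions

variable {M : ℕ} {J : EuclideanSpace ℝ (Fin M) → ℝ} {wo : EuclideanSpace ℝ (Fin M)} {ν δ : ℝ}

theorem pos_upper (h : CostConditions J wo ν δ) : 0 < δ := h.pos.trans_le h.le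

/-- Symmetry is part of positive semidefiniteness, so no continuity of the second derivative is
needed. -/
theorem isHermitian (h : CostConditions J wo ν δ) (w : EuclideanSpace ℝ (Fin M)) :
    (hessianMatrix J w).IsHermitian := by
  have h1 := (h.lower w).isHermitian
  have h2 : (ν • (1 : Matrix (Fin M) (Fin M) ℝ)).IsHermitian := by
    simp [Matrix.IsHermitian]
  simpa using h1.add h2

theorem isSymmetric (h : CostConditions J wo ν δ) (w x y : EuclideanSpace ℝ (Fin M)) :
    ⟪fderiv ℝ (gradient J) w x, y⟫ = ⟪x, fderiv ℝ (gradient J) w y⟫ := by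
  rw [← toEuclideanCLM_hessianMatrix]
  exact (Matrix.isSymmetric_toEuclideanLin_iff.mpr (h.isHermitian w)) x y

theorem lower_inner (h : CostConditions J wo ν δ) (w x : EuclideanSpace ℝ (Fin M)) :
    ν * ‖x‖ ^ 2 ≤ ⟪x, fderiv ℝ (gradient J) w x⟫ := by
  have h1 := (h.lower w).dotProduct_mulVec_nonneg x.ofLp
  rw [← toEuclideanCLM_hessianMatrix, Matrix.inner_toEuclideanCLM]
  have h2 : x.ofLp ⬝ᵥ x.ofLp = ‖x‖ ^ 2 := by
    rw [EuclideanSpace.norm_sq_eq]; simp [dotProduct, sq]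
  simp [Matrix.sub_mulVec, Matrix.smul_mulVec, h2] at h1
  linarith

theorem upper_inner (h : CostConditions J wo ν δ) (w x : EuclideanSpace ℝ (Fin M)) :
    ⟪x, fderiv ℝ (gradient J) w x⟫ ≤ δ * ‖x‖ ^ 2 := by
  have h1 := (h.upper w).dotProduct_mulVec_nonneg x.ofLp
  rw [← toEuclideanCLM_hessianMatrix, Matrix.inner_toEuclideanCLM]
  have h2 : x.ofLp ⬝ᵥ x.ofLp = ‖x‖ ^ 2 := by
    rw [EuclideanSpace.norm_sq_eq]; simp [dotProduct, sq]
  simp [Matrix.sub_mulVec, Matrix.smul_mulVec, h2] at h1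
  linarith

theorem norm_fderiv_apply_le (h : CostConditions J wo ν δ) (w x : EuclideanSpace ℝ (Fin M)) :
    ‖fderiv ℝ (gradient J) w x‖ ≤ δ * ‖x‖ := by
  set T := fderiv ℝ (gradient J) w
  have hδ := h.pos_upper
  set y := δ⁻¹ • T x with hy
  have hTx : T x = δ • y := by rw [hy, smul_smul, mul_inv_cancel₀ hδ.ne', one_smul]
  -- Polarization: by symmetry the forms at `x + y` and `x - y` differ by `4⟪y, T x⟫ = 4δ‖y‖²`. The
  -- first is at most `δ‖x + y‖²` and the second is nonnegative, so `2‖y‖ ≤ ‖x + y‖`, whence `‖y‖ ≤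
  -- ‖x‖`.
  have h1 := h.upper_inner w (x + y)
  have h2 := (mul_nonneg h.pos.le (sq_nonneg _)).trans (h.lower_inner w (x - y))
  have h3 := h.isSymmetric w x y
  change ⟪x + y, T (x + y)⟫ ≤ _ at h1
  change 0 ≤ ⟪x - y, T (x - y)⟫ at h2
  change ⟪T x, y⟫ = ⟪x, T y⟫ at h3
  simp only [map_add, map_sub, inner_add_left, inner_add_right, inner_sub_left,
    inner_sub_right] at h1 h2
  have h4 : ⟪y, T x⟫ = δ * ‖y‖ ^ 2 := by
    rw [hTx, real_inner_smul_right, real_inner_self_eq_norm_sq]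
  have h5 : ⟪x, T y⟫ = δ * ‖y‖ ^ 2 := by
    rw [← h3, real_inner_comm, h4]
  have h6 : 4 * ‖y‖ ^ 2 ≤ ‖x + y‖ ^ 2 := by
    have : δ * (4 * ‖y‖ ^ 2) ≤ δ * ‖x + y‖ ^ 2 := by linarith
    exact le_of_mul_le_mul_left this hδ
  have h7 : 2 * ‖y‖ ≤ ‖x + y‖ :=
    abs_le_of_sq_le_sq' (by linarith) (norm_nonneg _) |>.2
  have h8 := norm_add_le x y
  rw [hTx, norm_smul, Real.norm_eq_abs, abs_of_pos hδ]
  exact mul_le_mul_of_nonneg_left (by linarith) hδ.le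

theorem norm_fderiv_le (h : CostConditions J wo ν δ) (w : EuclideanSpace ℝ (Fin M)) :
    ‖fderiv ℝ (gradient J) w‖ ≤ δ :=
  ContinuousLinearMap.opNorm_le_bound _ h.pos_upper.le (h.norm_fderiv_apply_le w)

theorem gradient_minimizer (h : CostConditions J wo ν δ) : gradient J wo = 0 := by
  have h1 : IsLocalMin J wo := Eventually.of_forall h.minimizer
  rw [gradient, h1.fderiv_eq_zero, map_zero]

theorem norm_gradient_le (h : CostConditions J wo ν δ) (w : EuclideanSpace ℝ (Fin M)) :
    ‖gradient J w‖ ≤ δ * ‖w - wo‖ := by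
  have := Convex.norm_image_sub_le_of_norm_fderiv_le (𝕜 := ℝ) (f := gradient J) (s := Set.univ)
    (fun x _ => h.differentiable_gradient x) (fun x _ => h.norm_fderiv_le x) convex_univ
    (Set.mem_univ wo) (Set.mem_univ w)
  simpa [h.gradient_minimizer] using this

theorem hasDerivAt_gradient_line (h : CostConditions J wo ν δ) (d : EuclideanSpace ℝ (Fin M))
    (t : ℝ) :
    HasDerivAt (fun t : ℝ => ⟪d, gradient J (wo + t • d)⟫)
      ⟪d, fderiv ℝ (gradient J) (wo + t • d) d⟫ t := by
  have h1 : HasDerivAt (fun t : ℝ => wo + t • d) d t := by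
    simpa using ((hasDerivAt_id t).smul_const d).const_add wo
  have h2 := (h.differentiable_gradient (wo + t • d)).hasFDerivAt.comp_hasDerivAt t h1
  exact (innerSL ℝ d).hasFDerivAt.comp_hasDerivAt t h2

theorem le_inner_gradient (h : CostConditions J wo ν δ) (w : EuclideanSpace ℝ (Fin M)) :
    ν * ‖w - wo‖ ^ 2 ≤ ⟪w - wo, gradient J w⟫ := by
  set d := w - wo with hd
  -- Mean value theorem on `[0, 1]` along the segment from `wo`, where the gradient vanishes.
  obtain ⟨c, -, hc⟩ := exists_hasDerivAt_eq_slope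
    (fun t : ℝ => ⟪d, gradient J (wo + t • d)⟫) _ one_pos
    (fun t _ => (h.hasDerivAt_gradient_line d t).continuousAt.continuousWithinAt)
    (fun t _ => h.hasDerivAt_gradient_line d t)
  have h1 := h.lower_inner (wo + c • d) d
  have hw : wo + d = w := by rw [hd]; abel
  simp only [one_smul, zero_smul, add_zero, h.gradient_minimizer, inner_zero_right, sub_zero,
    div_one, hw] at hc
  rwa [hc] at h1

theorem hasGradientAt (h : CostConditions J wo ν δ) (w : EuclideanSpace ℝ (Fin M)) :
    HasGradientAt J (gradient J w) w := (h.differentiable w).hasGradientAt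

theorem sub_le (h : CostConditions J wo ν δ) (w : EuclideanSpace ℝ (Fin M)) :
    |J w - J wo| ≤ δ * ‖w - wo‖ ^ 2 := by
  have := Convex.norm_image_sub_le_of_norm_fderiv_le (𝕜 := ℝ) (f := J)
    (s := Metric.closedBall wo ‖w - wo‖) (C := δ * ‖w - wo‖)
    (fun x _ => h.differentiable x) (fun x hx => ?_) (convex_closedBall _ _)
    (Metric.mem_closedBall_self (norm_nonneg _)) (by simp [dist_eq_norm] : w ∈ _)
  · rw [Real.norm_eq_abs] at this
    calc _ ≤ _ := this
      _ = _ := by ring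
  · have h1 : ‖fderiv ℝ J x‖ = ‖gradient J x‖ := by
      rw [gradient, LinearIsometryEquiv.norm_map]
    rw [h1]
    refine (h.norm_gradient_le x).trans ?_
    rw [Metric.mem_closedBall, dist_eq_norm] at hx
    exact mul_le_mul_of_nonneg_left hx h.pos_upper.le

/-- The deviation of the gradient from its linearization at the minimizer. -/
noncomputable def _root_.gradRem {M : ℕ} (J : EuclideanSpace ℝ (Fin M) → ℝ) (wo w : EuclideanSpace ℝ (Fin M)) :
    EuclideanSpace ℝ (Fin M) :=
  gradient J w - fderiv ℝ (gradient J) wo (w - wo)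

/-- The deviation of the cost from its quadratic approximation at the minimizer. -/
noncomputable def _root_.costRem {M : ℕ} (J : EuclideanSpace ℝ (Fin M) → ℝ) (wo w : EuclideanSpace ℝ (Fin M)) :
    ℝ :=
  J w - J wo - 1 / 2 * ⟪w - wo, fderiv ℝ (gradient J) wo (w - wo)⟫

theorem hasFDerivAt_gradRem (h : CostConditions J wo ν δ) (w : EuclideanSpace ℝ (Fin M)) :
    HasFDerivAt (gradRem J wo) (fderiv ℝ (gradient J) w - fderiv ℝ (gradient J) wo) w := by
  have h1 := (h.differentiable_gradient w).hasFDerivAt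
  have h2 := (fderiv ℝ (gradient J) wo).hasFDerivAt.comp w ((hasFDerivAt_id w).sub_const wo)
  exact h1.sub h2

theorem gradRem_self (h : CostConditions J wo ν δ) : gradRem J wo wo = 0 := by
  simp [gradRem, h.gradient_minimizer]

/-- By symmetry of the Hessian at `wo`, the gradient of the cost remainder is the gradient
remainder. One more mean value estimate thus transfers bounds from the latter to the former, gaining
a factor `‖w - wo‖`. -/
theorem hasFDerivAt_costRem (h : CostConditions J wo ν δ) (w : EuclideanSpace ℝ (Fin M)) :
    HasFDerivAt (costRem J wo) (innerSL ℝ (gradRem J wo w)) w := by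
  have h1 := (h.hasGradientAt w).hasFDerivAt.sub_const (J wo)
  have h0 := (hasFDerivAt_id (𝕜 := ℝ) w).sub_const wo
  have h2 := (fderiv ℝ (gradient J) wo).hasFDerivAt.comp w h0
  have h3 := (h0.inner ℝ h2).const_mul (1 / 2)
  refine (h1.sub h3).congr_fderiv ?_
  ext d
  simp [gradRem, inner_sub_left]
  rw [inner_sub_right]
  linarith [h.isSymmetric wo w d, h.isSymmetric wo wo d, real_inner_comm d (fderiv ℝ (gradient J) wo w),
    real_inner_comm d (fderiv ℝ (gradient J) wo wo)]

theorem norm_gradRem_le (h : CostConditions J wo ν δ) {C R : ℝ}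
    (hC : ∀ w, ‖w - wo‖ ≤ R → ‖fderiv ℝ (gradient J) w - fderiv ℝ (gradient J) wo‖ ≤ C)
    (w : EuclideanSpace ℝ (Fin M)) (hw : ‖w - wo‖ ≤ R) :
    ‖gradRem J wo w‖ ≤ C * ‖w - wo‖ := by
  have := Convex.norm_image_sub_le_of_norm_hasFDerivWithin_le (𝕜 := ℝ) (f := gradRem J wo)
    (s := Metric.closedBall wo R)
    (fun x _ => (h.hasFDerivAt_gradRem x).hasFDerivWithinAt)
    (fun x hx => hC x (by simpa [dist_eq_norm] using hx)) (convex_closedBall _ _)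
    (Metric.mem_closedBall_self ((norm_nonneg _).trans hw)) (by simpa [dist_eq_norm] : w ∈ _)
  simpa [h.gradRem_self] using this

theorem abs_costRem_le (h : CostConditions J wo ν δ) {C R : ℝ}
    (hC : ∀ w, ‖w - wo‖ ≤ R → ‖gradRem J wo w‖ ≤ C)
    (w : EuclideanSpace ℝ (Fin M)) (hw : ‖w - wo‖ ≤ R) :
    |costRem J wo w| ≤ C * ‖w - wo‖ := by
  have := Convex.norm_image_sub_le_of_norm_hasFDerivWithin_le (𝕜 := ℝ) (f := costRem J wo)
    (s := Metric.closedBall wo R)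
    (fun x _ => (h.hasFDerivAt_costRem x).hasFDerivWithinAt)
    (fun x hx => by
      rw [innerSL_apply_norm]; exact hC x (by simpa [dist_eq_norm] using hx))
    (convex_closedBall _ _)
    (Metric.mem_closedBall_self ((norm_nonneg _).trans hw)) (by simpa [dist_eq_norm] : w ∈ _)
  simpa [costRem] using this

theorem gradRem_eq_zero (h : CostConditions J wo ν δ)
    (hc : ∀ w, hessianMatrix J w = hessianMatrix J wo) (w : EuclideanSpace ℝ (Fin M)) :
    gradRem J wo w = 0 := by
  have := h.norm_gradRem_le (C := 0) (R := ‖w - wo‖) (fun x _ => by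
    rw [← toEuclideanCLM_hessianMatrix, ← toEuclideanCLM_hessianMatrix, hc]; simp) w le_rfl
  simpa using this

theorem costRem_eq_zero (h : CostConditions J wo ν δ)
    (hc : ∀ w, hessianMatrix J w = hessianMatrix J wo) (w : EuclideanSpace ℝ (Fin M)) :
    costRem J wo w = 0 := by
  have := h.abs_costRem_le (C := 0) (R := ‖w - wo‖) (fun x _ => by
    simp [h.gradRem_eq_zero hc]) w le_rfl
  simpa using this

theorem norm_gradRem_le_linear (h : CostConditions J wo ν δ) (w : EuclideanSpace ℝ (Fin M)) :
    ‖gradRem J wo w‖ ≤ 2 * δ * ‖w - wo‖ :=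
  h.norm_gradRem_le (R := ‖w - wo‖) (fun x _ => (norm_sub_le _ _).trans (by
    linarith [h.norm_fderiv_le x, h.norm_fderiv_le wo])) w le_rfl

open scoped Matrix.Norms.L2Operator in
theorem norm_fderiv_sub_le {τ r : ℝ} (hH : HessianLipschitzAt J wo τ r)
    (w : EuclideanSpace ℝ (Fin M)) (hw : ‖w - wo‖ ≤ r) :
    ‖fderiv ℝ (gradient J) w - fderiv ℝ (gradient J) wo‖ ≤ τ * ‖w - wo‖ := by
  have := hH (w - wo) hw
  rw [add_sub_cancel, Matrix.cstar_norm_def, map_sub, toEuclideanCLM_hessianMatrix,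
    toEuclideanCLM_hessianMatrix] at this
  exact this

/-- The local Lipschitz condition suffices for a global bound: outside the ball `‖w - wo‖ ≥ r`, and
the linear bound is dominated by a quadratic one at the price of a factor `1 / r`. -/
theorem norm_gradRem_le_quadratic (h : CostConditions J wo ν δ) {τ r : ℝ} (hr : 0 < r)
    (hτ : 0 ≤ τ) (hH : HessianLipschitzAt J wo τ r) (w : EuclideanSpace ℝ (Fin M)) :
    ‖gradRem J wo w‖ ≤ (τ + 2 * δ / r) * ‖w - wo‖ ^ 2 := by
  have hδ := h.pos_upper
  rcases le_total ‖w - wo‖ r with hw | hw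
  · have := h.norm_gradRem_le (C := τ * ‖w - wo‖) (R := ‖w - wo‖) (fun x hx =>
      (norm_fderiv_sub_le hH x (hx.trans hw)).trans (by gcongr)) w le_rfl
    calc _ ≤ _ := this
      _ = τ * ‖w - wo‖ ^ 2 := by ring
      _ ≤ _ := by gcongr; simp; positivity
  · calc _ ≤ _ := h.norm_gradRem_le_linear w
      _ = 2 * δ / r * (r * ‖w - wo‖) := by field_simp
      _ ≤ 2 * δ / r * (‖w - wo‖ * ‖w - wo‖) := by gcongr
      _ = 2 * δ / r * ‖w - wo‖ ^ 2 := by ring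
      _ ≤ _ := by gcongr; simp; exact hτ

/-- Both growth rates are kept: the linear one is usable where only second moments of the error
exist, the quadratic one where fourth moments do. -/
theorem norm_gradRem_le_min (h : CostConditions J wo ν δ) {τ r : ℝ} (hr : 0 < r)
    (hτ : 0 ≤ τ) (hH : HessianLipschitzAt J wo τ r) (w : EuclideanSpace ℝ (Fin M)) :
    ‖gradRem J wo w‖ ≤ (τ + 2 * δ / r + 2 * δ) * min ‖w - wo‖ (‖w - wo‖ ^ 2) := by
  have hδ := h.pos_upper
  have h0 : 0 ≤ 2 * δ / r := by positivity
  rcases min_choice ‖w - wo‖ (‖w - wo‖ ^ 2) with hm | hm <;> rw [hm]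
  · exact (h.norm_gradRem_le_linear w).trans (by gcongr; linarith)
  · exact (h.norm_gradRem_le_quadratic hr hτ hH w).trans
      (mul_le_mul_of_nonneg_right (by linarith) (sq_nonneg _))

theorem abs_costRem_le_min (h : CostConditions J wo ν δ) {τ r : ℝ} (hr : 0 < r)
    (hτ : 0 ≤ τ) (hH : HessianLipschitzAt J wo τ r) (w : EuclideanSpace ℝ (Fin M)) :
    |costRem J wo w| ≤ (τ + 2 * δ / r + 2 * δ) * min (‖w - wo‖ ^ 2) (‖w - wo‖ ^ 3) := by
  have hδ := h.pos_upper
  have := h.abs_costRem_le (R := ‖w - wo‖)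
    (C := (τ + 2 * δ / r + 2 * δ) * min ‖w - wo‖ (‖w - wo‖ ^ 2)) (fun x hx =>
      (h.norm_gradRem_le_min hr hτ hH x).trans (by gcongr)) w le_rfl
  refine this.trans (le_of_eq ?_)
  rw [mul_assoc, min_mul_of_nonneg _ _ (norm_nonneg _)]
  ring_nf

end CostConditions

/-! ### Scalar contractions and their asymptotic bounds. -/

theorem eventually_le_of_le_contraction {y : ℕ → ℝ} {a b c : ℝ} (ha : 0 < a) (ha1 : a ≤ 1)
    (hc : b / a < c) (hy : ∀ᶠ i in atTop, y (i + 1) ≤ (1 - a) * y i + b) :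
    ∀ᶠ i in atTop, y i ≤ c := by
  obtain ⟨N, hN⟩ := eventually_atTop.mp hy
  -- The excess over the fixed point `b / a` decays geometrically; the strict inequality `b / a < c`
  -- absorbs this transient, so the final bound does not see the initial value.
  have h1 : ∀ n, y (N + n) - b / a ≤ (1 - a) ^ n * |y N - b / a| := by
    intro n
    induction n with
    | zero => simpa using le_abs_self (y N - b / a)
    | succ n ih =>
      have h2 := hN (N + n) (by omega)
      have h3 : (1 - a) * (y (N + n) - b / a) ≤ (1 - a) * ((1 - a) ^ n * |y N - b / a|) :=
        mul_le_mul_of_nonneg_left ih (by linarith)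
      have h4 : a * (b / a) = b := by field_simp
      rw [← add_assoc, pow_succ]
      nlinarith
  have h2 : Tendsto (fun n : ℕ => (1 - a) ^ n * |y N - b / a|) atTop (𝓝 0) := by
    simpa using (tendsto_pow_atTop_nhds_zero_of_lt_one (by linarith) (by linarith)).mul_const
      |y N - b / a|
  obtain ⟨K, hK⟩ := eventually_atTop.mp (h2.eventually_lt_const (sub_pos.mpr hc))
  refine eventually_atTop.mpr ⟨N + K, fun i hi => ?_⟩
  obtain ⟨n, rfl⟩ := Nat.exists_eq_add_of_le (by omega : N ≤ i)
  linarith [h1 n, hK n (by omega)]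

theorem eventually_abs_sub_le_of_contraction {x e : ℕ → ℝ} {a b c L : ℝ} (ha : 0 < a)
    (ha1 : a ≤ 1) (hc : b / a < c)
    (hx : ∀ᶠ i in atTop, x (i + 1) - L = (1 - a) * (x i - L) + e i)
    (he : ∀ᶠ i in atTop, |e i| ≤ b) :
    ∀ᶠ i in atTop, |x i - L| ≤ c := by
  refine eventually_le_of_le_contraction (y := fun i => |x i - L|) ha ha1 hc ?_
  filter_upwards [hx, he] with i h1 h2
  rw [h1]
  refine (abs_add_le _ _).trans ?_
  rw [abs_mul, abs_of_nonneg (by linarith : (0 : ℝ) ≤ 1 - a)]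
  linarith

theorem abs_limsup_sub_le {x : ℕ → ℝ} {L c : ℝ} (h : ∀ᶠ i in atTop, |x i - L| ≤ c) :
    |limsup x atTop - L| ≤ c ∧ |liminf x atTop - L| ≤ c := by
  have hu : ∀ᶠ i in atTop, x i ≤ L + c := h.mono fun i hi => by linarith [(abs_le.mp hi).2]
  have hl : ∀ᶠ i in atTop, L - c ≤ x i := h.mono fun i hi => by linarith [(abs_le.mp hi).1]
  have bu : IsBoundedUnder (· ≤ ·) atTop x := ⟨L + c, by simpa using hu⟩
  have bl : IsBoundedUnder (· ≥ ·) atTop x := ⟨L - c, by simpa using hl⟩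
  have h1 : limsup x atTop ≤ L + c := limsup_le_of_le bl.isCoboundedUnder_le hu
  have h2 : L - c ≤ liminf x atTop := le_liminf_of_le bu.isCoboundedUnder_ge hl
  have h3 : liminf x atTop ≤ limsup x atTop := liminf_le_limsup bu bl
  constructor <;> rw [abs_le] <;> constructor <;> linarith

/-! ### Moments of a single stochastic step. -/

theorem norm_add_smul_pow_four_le {E : Type*} [NormedAddCommGroup E]
    [InnerProductSpace ℝ E] (e g : E) (t : ℝ) :
    ‖e + t • g‖ ^ 4 ≤ ‖e‖ ^ 4 + 4 * (t ^ 1 * (‖e‖ ^ 2 * ⟪e, g⟫))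
      + 8 * (t ^ 2 * (‖e‖ ^ 2 * ‖g‖ ^ 2)) + 3 * (t ^ 4 * ‖g‖ ^ 4) := by
  have h1 : ‖e + t • g‖ ^ 2 = ‖e‖ ^ 2 + 2 * (t * ⟪e, g⟫) + t ^ 2 * ‖g‖ ^ 2 := by
    rw [norm_add_sq_real, real_inner_smul_right, norm_smul, mul_pow, Real.norm_eq_abs, sq_abs]
  have h2 : ⟪e, g⟫ ^ 2 ≤ ‖e‖ ^ 2 * ‖g‖ ^ 2 := by
    rw [← mul_pow, ← sq_abs]
    exact pow_le_pow_left₀ (abs_nonneg _) (abs_real_inner_le_norm e g) 2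
  have h3 : ‖e + t • g‖ ^ 4 = (‖e + t • g‖ ^ 2) ^ 2 := by ring
  rw [h3, h1]
  -- This trades the cubic term in `t` for second- and fourth-order ones, so only the first, second
  -- and fourth moments of the step-size will enter. With Cauchy–Schwarz it accounts for the
  -- constants `8 = 4 + 2 + 2` and `3 = 1 + 2`.
  have h4 := sq_nonneg (t * ⟪e, g⟫ - t ^ 2 * ‖g‖ ^ 2)
  have h5 := mul_le_mul_of_nonneg_left h2 (sq_nonneg t)
  nlinarith

theorem integrable_inner_of_memLp_two {Ω E : Type*} [MeasurableSpace Ω] [NormedAddCommGroup E]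
    [InnerProductSpace ℝ E] {P : Measure Ω} {f g : Ω → E} (hf : MemLp f 2 P) (hg : MemLp g 2 P) :
    Integrable (fun ω => ⟪f ω, g ω⟫) P := by
  refine ((hf.integrable_norm_pow two_ne_zero).add (hg.integrable_norm_pow two_ne_zero)).mono'
    (hf.1.inner hg.1) (ae_of_all _ fun ω => ?_)
  have h1 := abs_real_inner_le_norm (f ω) (g ω)
  simp only [Pi.add_apply, Real.norm_eq_abs]
  nlinarith [sq_nonneg (‖f ω‖ - ‖g ω‖), sq_nonneg (‖f ω‖ + ‖g ω‖)]

/-- One update `e + mu • (q + s)` of a stochastic recursion: `e` and `q` depend on the past `F`,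
`s` is noise with zero conditional mean, and the bounded step-size `mu` is independent of the
σ-algebra `G` carrying all of these. -/
structure StochStep {Ω E : Type*} (F G : MeasurableSpace Ω) [m : MeasurableSpace Ω]
    [NormedAddCommGroup E] [InnerProductSpace ℝ E] [CompleteSpace E] (P : Measure Ω)
    (mu : Ω → ℝ) (ub : ℝ) (e q s : Ω → E) : Prop where
  le : F ≤ G
  le_ambient : G ≤ m
  meas_e : StronglyMeasurable[F] e
  meas_q : StronglyMeasurable[F] q
  meas_s : StronglyMeasurable[G] s
  meas_mu : Measurable mu
  mem_Icc : ∀ᵐ ω ∂P, mu ω ∈ Set.Icc 0 ub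
  indep : Indep (MeasurableSpace.comap mu inferInstance) G P
  memLp_e : MemLp e 2 P
  memLp_q : MemLp q 2 P
  memLp_s : MemLp s 2 P
  mean_zero : P[s | F] =ᵐ[P] 0

namespace StochStep

variable {Ω E E' : Type*} {F G : MeasurableSpace Ω} [m : MeasurableSpace Ω] [NormedAddCommGroup E]
  [InnerProductSpace ℝ E] [CompleteSpace E] [NormedAddCommGroup E']
  [InnerProductSpace ℝ E'] [CompleteSpace E'] {P : Measure Ω} [IsProbabilityMeasure P]
  {mu : Ω → ℝ} {ub : ℝ} {e q s : Ω → E}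

/-- An event of the past commutes with conditioning on the past, so restricting to it gives another
step. This makes all moment recursions available on events. -/
theorem indicator (h : StochStep F G P mu ub e q s) {B : Set Ω}
    (hB : MeasurableSet[F] B) :
    StochStep F G P mu ub (B.indicator e) (B.indicator q) (B.indicator s) where
  le := h.le
  le_ambient := h.le_ambient
  meas_e := h.meas_e.indicator hB
  meas_q := h.meas_q.indicator hB
  meas_s := h.meas_s.indicator (h.le _ hB)
  meas_mu := h.meas_mu
  mem_Icc := h.mem_Icc
  indep := h.indep
  memLp_e := h.memLp_e.indicator (h.le_ambient _ (h.le _ hB))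
  memLp_q := h.memLp_q.indicator (h.le_ambient _ (h.le _ hB))
  memLp_s := h.memLp_s.indicator (h.le_ambient _ (h.le _ hB))
  mean_zero := by
    filter_upwards [condExp_indicator (h.memLp_s.integrable one_le_two) hB, h.mean_zero]
      with ω h1 h2
    rw [h1]
    simp [Set.indicator, h2]

/-- Applied with `L = ⟪u, ·⟫`, this turns the vector recursion into a scalar one along `u`. -/
theorem comp (h : StochStep F G P mu ub e q s) (L : E →L[ℝ] E') :
    StochStep F G P mu ub (fun ω => L (e ω)) (fun ω => L (q ω)) (fun ω => L (s ω)) where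
  le := h.le
  le_ambient := h.le_ambient
  meas_e := L.continuous.comp_stronglyMeasurable h.meas_e
  meas_q := L.continuous.comp_stronglyMeasurable h.meas_q
  meas_s := L.continuous.comp_stronglyMeasurable h.meas_s
  meas_mu := h.meas_mu
  mem_Icc := h.mem_Icc
  indep := h.indep
  memLp_e := L.comp_memLp' h.memLp_e
  memLp_q := L.comp_memLp' h.memLp_q
  memLp_s := L.comp_memLp' h.memLp_s
  mean_zero := by
    filter_upwards [L.comp_condExp_comm (h.memLp_s.integrable one_le_two) (m := F), h.mean_zero]
      with ω h1 h2
    change P[L ∘ s | F] ω = 0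
    rw [← h1]
    simp [h2]

/-- The factor `f` is known given `F`, so it can be pulled out of the conditional expectation, which
leaves the zero conditional mean of `s`. -/
theorem integral_inner_noise (h : StochStep F G P mu ub e q s) {f : Ω → E}
    (hf : StronglyMeasurable[F] f) (hfs : Integrable (fun ω => ⟪f ω, s ω⟫) P) :
    ∫ ω, ⟪f ω, s ω⟫ ∂P = 0 := by
  have h1 := condExp_bilin_of_stronglyMeasurable_left (m := F) (innerSL ℝ) hf hfs
    (h.memLp_s.integrable one_le_two)
  rw [← integral_condExp (h.le.trans h.le_ambient), integral_congr_ae (g := fun _ => (0 : ℝ)),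
    integral_zero]
  filter_upwards [h1, h.mean_zero] with ω h2 h3
  rw [h3] at h2
  exact h2.trans (by simp)

theorem integrable_step_pow (h : StochStep F G P mu ub e q s) (k : ℕ) :
    Integrable (fun ω => mu ω ^ k) P := by
  refine Integrable.mono' (integrable_const (ub ^ k)) (h.meas_mu.pow_const k).aestronglyMeasurable ?_
  filter_upwards [h.mem_Icc] with ω hω
  rw [Real.norm_eq_abs, abs_of_nonneg (pow_nonneg hω.1 k)]
  exact pow_le_pow_left₀ hω.1 hω.2 k

theorem indepFun_step_pow (h : StochStep F G P mu ub e q s) (k : ℕ) {X : Ω → ℝ}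
    (hX : StronglyMeasurable[G] X) : IndepFun (fun ω => mu ω ^ k) X P := by
  have h1 : IndepFun mu X P := by
    rw [IndepFun_iff_Indep]
    exact indep_of_indep_of_le_right h.indep hX.measurable.comap_le
  exact h1.comp (measurable_id.pow_const k) measurable_id

theorem integrable_step_pow_mul (h : StochStep F G P mu ub e q s) (k : ℕ) {X : Ω → ℝ}
    (hX : StronglyMeasurable[G] X) (hXi : Integrable X P) :
    Integrable (fun ω => mu ω ^ k * X ω) P :=
  (h.indepFun_step_pow k hX).integrable_mul (h.integrable_step_pow k) hXi

theorem integral_step_pow_mul (h : StochStep F G P mu ub e q s) (k : ℕ) {X : Ω → ℝ}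
    (hX : StronglyMeasurable[G] X) :
    ∫ ω, mu ω ^ k * X ω ∂P = (∫ ω, mu ω ^ k ∂P) * ∫ ω, X ω ∂P :=
  (h.indepFun_step_pow k hX).integral_fun_mul_eq_mul_integral
    (h.meas_mu.pow_const k).aestronglyMeasurable
    (hX.mono h.le_ambient).aestronglyMeasurable

theorem meas_grad (h : StochStep F G P mu ub e q s) : StronglyMeasurable[G] (fun ω => q ω + s ω) :=
  (h.meas_q.mono h.le).add h.meas_s

theorem integral_norm_sq_grad (h : StochStep F G P mu ub e q s) :
    ∫ ω, ‖q ω + s ω‖ ^ 2 ∂P = ∫ ω, ‖q ω‖ ^ 2 ∂P + ∫ ω, ‖s ω‖ ^ 2 ∂P := by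
  have hq := h.memLp_q.integrable_norm_pow two_ne_zero
  have hs := h.memLp_s.integrable_norm_pow two_ne_zero
  have hqs : Integrable (fun ω => ⟪q ω, s ω⟫) P := integrable_inner_of_memLp_two h.memLp_q h.memLp_s
  have h1 := h.integral_inner_noise h.meas_q hqs
  simp_rw [norm_add_sq_real]
  have hqqs : Integrable (fun ω => ‖q ω‖ ^ 2 + 2 * ⟪q ω, s ω⟫) P := hq.add (hqs.const_mul 2)
  rw [integral_add hqqs hs, integral_add hq (hqs.const_mul 2),
    integral_const_mul, h1]
  ring

/-- The update is square integrable. -/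
theorem memLp_update (h : StochStep F G P mu ub e q s) :
    MemLp (fun ω => e ω + mu ω • (q ω + s ω)) 2 P := by
  have h2 : MemLp mu ∞ P := by
    refine memLp_top_of_bound h.meas_mu.aestronglyMeasurable ub ?_
    filter_upwards [h.mem_Icc] with ω hω
    rw [Real.norm_eq_abs, abs_of_nonneg hω.1]
    exact hω.2
  exact h.memLp_e.add ((h.memLp_q.add h.memLp_s).smul h2)

theorem integral_norm_sq_update (h : StochStep F G P mu ub e q s) :
    ∫ ω, ‖e ω + mu ω • (q ω + s ω)‖ ^ 2 ∂P
      = ∫ ω, ‖e ω‖ ^ 2 ∂P + 2 * (∫ ω, mu ω ∂P) * ∫ ω, ⟪e ω, q ω⟫ ∂P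
        + (∫ ω, mu ω ^ 2 ∂P) * (∫ ω, ‖q ω‖ ^ 2 ∂P + ∫ ω, ‖s ω‖ ^ 2 ∂P) := by
  have he := h.memLp_e.integrable_norm_pow two_ne_zero
  have hg : Integrable (fun ω => ‖q ω + s ω‖ ^ 2) P :=
    (h.memLp_q.add h.memLp_s).integrable_norm_pow two_ne_zero
  have heq : Integrable (fun ω => ⟪e ω, q ω⟫) P := integrable_inner_of_memLp_two h.memLp_e h.memLp_q
  have hes : Integrable (fun ω => ⟪e ω, s ω⟫) P := integrable_inner_of_memLp_two h.memLp_e h.memLp_s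
  have hmg : StronglyMeasurable[G] (fun ω => ‖q ω + s ω‖ ^ 2) := h.meas_grad.norm.pow 2
  have hmi : StronglyMeasurable[G] (fun ω => ⟪e ω, q ω + s ω⟫) :=
    (h.meas_e.mono h.le).inner h.meas_grad
  have hei : Integrable (fun ω => ⟪e ω, q ω + s ω⟫) P := by
    simp_rw [inner_add_right]; exact heq.add hes
  have h1 : ∀ ω, ‖e ω + mu ω • (q ω + s ω)‖ ^ 2
      = ‖e ω‖ ^ 2 + 2 * (mu ω ^ 1 * ⟪e ω, q ω + s ω⟫) + mu ω ^ 2 * ‖q ω + s ω‖ ^ 2 := by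
    intro ω
    rw [norm_add_sq_real, real_inner_smul_right, norm_smul, mul_pow, Real.norm_eq_abs, sq_abs,
      pow_one]
  simp_rw [h1]
  have i1 := (h.integrable_step_pow_mul 1 hmi hei).const_mul 2
  have i2 := h.integrable_step_pow_mul 2 hmg hg
  have i3 : Integrable (fun ω => ‖e ω‖ ^ 2 + 2 * (mu ω ^ 1 * ⟪e ω, q ω + s ω⟫)) P := he.add i1
  rw [integral_add i3 i2, integral_add he i1, integral_const_mul,
    h.integral_step_pow_mul 1 hmi, h.integral_step_pow_mul 2 hmg, h.integral_norm_sq_grad]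
  simp_rw [inner_add_right, pow_one]
  rw [integral_add heq hes, h.integral_inner_noise h.meas_e hes]
  ring

theorem pow_four_update (h : StochStep F G P mu ub e q s)
    (he : Integrable (fun ω => ‖e ω‖ ^ 4) P) (hq : Integrable (fun ω => ‖q ω‖ ^ 4) P)
    (hs : Integrable (fun ω => ‖s ω‖ ^ 4) P) :
    Integrable (fun ω => ‖e ω + mu ω • (q ω + s ω)‖ ^ 4) P ∧
    ∫ ω, ‖e ω + mu ω • (q ω + s ω)‖ ^ 4 ∂P
      ≤ ∫ ω, ‖e ω‖ ^ 4 ∂P + 4 * (∫ ω, mu ω ∂P) * ∫ ω, ‖e ω‖ ^ 2 * ⟪e ω, q ω⟫ ∂P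
        + 8 * (∫ ω, mu ω ^ 2 ∂P) * ∫ ω, ‖e ω‖ ^ 2 * ‖q ω + s ω‖ ^ 2 ∂P
        + 3 * (∫ ω, mu ω ^ 4 ∂P) * ∫ ω, ‖q ω + s ω‖ ^ 4 ∂P := by
  have hFm := h.le.trans h.le_ambient
  have me := h.meas_e.mono hFm
  have mq := h.meas_q.mono hFm
  have ms := h.meas_s.mono h.le_ambient
  have mg : StronglyMeasurable[G] (fun ω => q ω + s ω) := h.meas_grad
  have mgm := mg.mono h.le_ambient
  have meG := h.meas_e.mono h.le
  have hg : Integrable (fun ω => ‖q ω + s ω‖ ^ 4) P := by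
    refine ((hq.add hs).const_mul 8).mono' (mgm.norm.pow 4).aestronglyMeasurable
      (ae_of_all _ fun ω => ?_)
    simp only [Pi.add_apply, norm_pow, norm_norm]
    have h1 := pow_le_pow_left₀ (norm_nonneg _) (norm_add_le (q ω) (s ω)) 4
    have h2 := add_pow_le (norm_nonneg (q ω)) (norm_nonneg (s ω)) 4
    norm_num at h2
    linarith
  have young : ∀ a b : ℝ, 0 ≤ a → 0 ≤ b → a ^ 3 * b ≤ a ^ 4 + b ^ 4 := by
    intro a b ha hb
    rcases le_total a b with hab | hab
    · calc a ^ 3 * b ≤ b ^ 3 * b := by gcongr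
        _ = b ^ 4 := by ring
        _ ≤ _ := by linarith [pow_nonneg ha 4]
    · calc a ^ 3 * b ≤ a ^ 3 * a := by gcongr
        _ = a ^ 4 := by ring
        _ ≤ _ := by linarith [pow_nonneg hb 4]
  have inner_bd : ∀ x y : E, ‖‖x‖ ^ 2 * ⟪x, y⟫‖ ≤ ‖x‖ ^ 4 + ‖y‖ ^ 4 := by
    intro x y
    refine le_trans ?_ (young _ _ (norm_nonneg x) (norm_nonneg y))
    rw [norm_mul, norm_pow, norm_norm, Real.norm_eq_abs]
    calc ‖x‖ ^ 2 * |⟪x, y⟫| ≤ ‖x‖ ^ 2 * (‖x‖ * ‖y‖) := by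
          gcongr; exact abs_real_inner_le_norm x y
      _ = _ := by ring
  have heq : Integrable (fun ω => ‖e ω‖ ^ 2 * ⟪e ω, q ω⟫) P :=
    (he.add hq).mono' ((me.norm.pow 2).mul (me.inner mq)).aestronglyMeasurable
      (ae_of_all _ fun ω => inner_bd _ _)
  have hes : Integrable (fun ω => ‖e ω‖ ^ 2 * ⟪e ω, s ω⟫) P :=
    (he.add hs).mono' ((me.norm.pow 2).mul (me.inner ms)).aestronglyMeasurable
      (ae_of_all _ fun ω => inner_bd _ _)
  -- The noise again drops out of the first-order term, now tested against `‖e‖² • e`.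
  have hes0 : ∫ ω, ‖e ω‖ ^ 2 * ⟪e ω, s ω⟫ ∂P = 0 := by
    have := h.integral_inner_noise (f := fun ω => ‖e ω‖ ^ 2 • e ω)
      ((h.meas_e.norm.pow 2).smul h.meas_e) (by simpa [real_inner_smul_left] using hes)
    simpa [real_inner_smul_left] using this
  have hei : Integrable (fun ω => ‖e ω‖ ^ 2 * ⟪e ω, q ω + s ω⟫) P := by
    simp_rw [inner_add_right, mul_add]; exact heq.add hes
  have heg : Integrable (fun ω => ‖e ω‖ ^ 2 * ‖q ω + s ω‖ ^ 2) P := by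
    refine (he.add hg).mono' ((me.norm.pow 2).mul (mgm.norm.pow 2)).aestronglyMeasurable
      (ae_of_all _ fun ω => ?_)
    simp only [Pi.add_apply, norm_mul, norm_pow, norm_norm]
    nlinarith [sq_nonneg (‖e ω‖ ^ 2 - ‖q ω + s ω‖ ^ 2), sq_nonneg (‖e ω‖ ^ 2),
      sq_nonneg (‖q ω + s ω‖ ^ 2)]
  have m1 : StronglyMeasurable[G] (fun ω => ‖e ω‖ ^ 2 * ⟪e ω, q ω + s ω⟫) :=
    (meG.norm.pow 2).mul (meG.inner mg)
  have m2 : StronglyMeasurable[G] (fun ω => ‖e ω‖ ^ 2 * ‖q ω + s ω‖ ^ 2) :=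
    (meG.norm.pow 2).mul (mg.norm.pow 2)
  have m4 : StronglyMeasurable[G] (fun ω => ‖q ω + s ω‖ ^ 4) := mg.norm.pow 4
  have i1 := (h.integrable_step_pow_mul 1 m1 hei).const_mul 4
  have i2 := (h.integrable_step_pow_mul 2 m2 heg).const_mul 8
  have i4 := (h.integrable_step_pow_mul 4 m4 hg).const_mul 3
  have hbd : ∀ᵐ ω ∂P, ‖e ω + mu ω • (q ω + s ω)‖ ^ 4 ≤ ‖e ω‖ ^ 4
      + 4 * (mu ω ^ 1 * (‖e ω‖ ^ 2 * ⟪e ω, q ω + s ω⟫))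
      + 8 * (mu ω ^ 2 * (‖e ω‖ ^ 2 * ‖q ω + s ω‖ ^ 2)) + 3 * (mu ω ^ 4 * ‖q ω + s ω‖ ^ 4) := by
    exact ae_of_all _ fun ω => norm_add_smul_pow_four_le _ _ _
  have hint : Integrable (fun ω => ‖e ω + mu ω • (q ω + s ω)‖ ^ 4) P := by
    refine (((he.add i1).add i2).add i4).mono'
      ((me.add (h.meas_mu.stronglyMeasurable.smul mgm)).norm.pow 4).aestronglyMeasurable ?_
    filter_upwards [hbd] with ω hω
    rw [norm_pow, norm_norm]
    exact hω
  refine ⟨hint, (integral_mono_ae hint (((he.add i1).add i2).add i4) hbd).trans (le_of_eq ?_)⟩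
  rw [integral_add' ((he.add i1).add i2) i4, integral_add' (he.add i1) i2, integral_add' he i1,
    integral_const_mul, integral_const_mul, integral_const_mul,
    h.integral_step_pow_mul 1 m1, h.integral_step_pow_mul 2 m2, h.integral_step_pow_mul 4 m4]
  simp_rw [inner_add_right, mul_add, pow_one]
  rw [integral_add heq hes, hes0]
  ring

end StochStep

/-! ### One-step bounds under strong monotonicity. -/

namespace StochStep

variable {Ω E : Type*} {F G : MeasurableSpace Ω} [m : MeasurableSpace Ω] [NormedAddCommGroup E]
  [InnerProductSpace ℝ E] [CompleteSpace E] {P : Measure Ω} [IsProbabilityMeasure P]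
  {mu : Ω → ℝ} {ub : ℝ} {e q s : Ω → E}

theorem integral_norm_sq_update_le (h : StochStep F G P mu ub e q s) {ν δ β c : ℝ}
    (hmono : ∀ ω, ⟪e ω, q ω⟫ ≤ -ν * ‖e ω‖ ^ 2) (hlip : ∀ ω, ‖q ω‖ ≤ δ * ‖e ω‖)
    (hs : ∫ ω, ‖s ω‖ ^ 2 ∂P ≤ β ^ 2 * ∫ ω, ‖e ω‖ ^ 2 ∂P + c) (hmean : 0 ≤ ∫ ω, mu ω ∂P) :
    ∫ ω, ‖e ω + mu ω • (q ω + s ω)‖ ^ 2 ∂P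
      ≤ (1 - 2 * ν * (∫ ω, mu ω ∂P) + (δ ^ 2 + β ^ 2) * ∫ ω, mu ω ^ 2 ∂P) * ∫ ω, ‖e ω‖ ^ 2 ∂P
        + (∫ ω, mu ω ^ 2 ∂P) * c := by
  have he := h.memLp_e.integrable_norm_pow two_ne_zero
  have h2 : 0 ≤ ∫ ω, mu ω ^ 2 ∂P := integral_nonneg fun ω => sq_nonneg _
  have heq : ∫ ω, ⟪e ω, q ω⟫ ∂P ≤ -ν * ∫ ω, ‖e ω‖ ^ 2 ∂P := by
    rw [← integral_const_mul]
    exact integral_mono (integrable_inner_of_memLp_two h.memLp_e h.memLp_q) (he.const_mul _) hmono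
  have hq : ∫ ω, ‖q ω‖ ^ 2 ∂P ≤ δ ^ 2 * ∫ ω, ‖e ω‖ ^ 2 ∂P := by
    rw [← integral_const_mul]
    refine integral_mono (h.memLp_q.integrable_norm_pow two_ne_zero) (he.const_mul _) fun ω => ?_
    simp only [← mul_pow]
    exact pow_le_pow_left₀ (norm_nonneg _) (hlip ω) 2
  rw [h.integral_norm_sq_update]
  have h3 := mul_le_mul_of_nonneg_left heq hmean
  have h4 := mul_le_mul_of_nonneg_left (add_le_add hq hs) h2
  linarith

theorem integral_norm_pow_four_update_le (h : StochStep F G P mu ub e q s)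
    {ν δ b c ρ mubar mux : ℝ} (hν : 0 < ν)
    (hmono : ∀ ω, ⟪e ω, q ω⟫ ≤ -ν * ‖e ω‖ ^ 2) (hlip : ∀ ω, ‖q ω‖ ≤ δ * ‖e ω‖)
    (he : Integrable (fun ω => ‖e ω‖ ^ 4) P) (hsi : Integrable (fun ω => ‖s ω‖ ^ 4) P)
    (hs : ∫ ω, ‖s ω‖ ^ 4 ∂P ≤ b ^ 4 * ∫ ω, ‖e ω‖ ^ 4 ∂P + c)
    (h1 : ∫ ω, mu ω ∂P = mubar) (h2 : ∫ ω, mu ω ^ 2 ∂P = mubar * mux)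
    (h4 : ∫ ω, mu ω ^ 4 ∂P ≤ ρ * mubar * mux ^ 2) (hmubar : 0 ≤ mubar) (hρ : 0 ≤ ρ) :
    Integrable (fun ω => ‖e ω + mu ω • (q ω + s ω)‖ ^ 4) P ∧
    ∫ ω, ‖e ω + mu ω • (q ω + s ω)‖ ^ 4 ∂P ≤ (1 - 3 * ν * mubar) * ∫ ω, ‖e ω‖ ^ 4 ∂P
      + mubar * mux ^ 2 * (16 / ν + 3 * ρ)
        * (8 * ((δ ^ 4 + b ^ 4) * ∫ ω, ‖e ω‖ ^ 4 ∂P + c)) := by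
  have hFm := h.le.trans h.le_ambient
  have me := h.meas_e.mono hFm
  have mq := h.meas_q.mono hFm
  have hqb : ∀ ω, ‖q ω‖ ^ 4 ≤ δ ^ 4 * ‖e ω‖ ^ 4 := fun ω => by
    rw [← mul_pow]; exact pow_le_pow_left₀ (norm_nonneg _) (hlip ω) 4
  have hqi : Integrable (fun ω => ‖q ω‖ ^ 4) P :=
    (he.const_mul (δ ^ 4)).mono' (mq.norm.pow 4).aestronglyMeasurable
      (ae_of_all _ fun ω => by simpa using hqb ω)
  obtain ⟨hint, hle⟩ := h.pow_four_update he hqi hsi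
  refine ⟨hint, hle.trans ?_⟩
  have hgb : ∀ ω, ‖q ω + s ω‖ ^ 4 ≤ 8 * (‖q ω‖ ^ 4 + ‖s ω‖ ^ 4) := fun ω => by
    have e1 := pow_le_pow_left₀ (norm_nonneg _) (norm_add_le (q ω) (s ω)) 4
    have e2 := add_pow_le (norm_nonneg (q ω)) (norm_nonneg (s ω)) 4
    norm_num at e2
    linarith
  have hgi : Integrable (fun ω => ‖q ω + s ω‖ ^ 4) P :=
    ((hqi.add hsi).const_mul 8).mono'
      ((h.meas_grad.mono h.le_ambient).norm.pow 4).aestronglyMeasurable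
      (ae_of_all _ fun ω => by simpa using hgb ω)
  have hg : ∫ ω, ‖q ω + s ω‖ ^ 4 ∂P ≤ 8 * ((δ ^ 4 + b ^ 4) * ∫ ω, ‖e ω‖ ^ 4 ∂P + c) := by
    calc _ ≤ ∫ ω, 8 * (‖q ω‖ ^ 4 + ‖s ω‖ ^ 4) ∂P :=
          integral_mono hgi ((hqi.add hsi).const_mul 8) hgb
      _ = 8 * (∫ ω, ‖q ω‖ ^ 4 ∂P + ∫ ω, ‖s ω‖ ^ 4 ∂P) := by
          rw [integral_const_mul, integral_add hqi hsi]
      _ ≤ 8 * (δ ^ 4 * ∫ ω, ‖e ω‖ ^ 4 ∂P + (b ^ 4 * ∫ ω, ‖e ω‖ ^ 4 ∂P + c)) := by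
          gcongr
          rw [← integral_const_mul]
          exact integral_mono hqi (he.const_mul _) hqb
      _ = _ := by ring
  have hcross : ∫ ω, ‖e ω‖ ^ 2 * ⟪e ω, q ω⟫ ∂P ≤ -ν * ∫ ω, ‖e ω‖ ^ 4 ∂P := by
    rw [← integral_const_mul]
    refine integral_mono ((he.const_mul |δ|).mono'
      ((me.norm.pow 2).mul (me.inner mq)).aestronglyMeasurable (ae_of_all _ fun ω => ?_))
      (he.const_mul _) fun ω => ?_
    · rw [norm_mul, norm_pow, norm_norm, Real.norm_eq_abs]
      calc ‖e ω‖ ^ 2 * |⟪e ω, q ω⟫| ≤ ‖e ω‖ ^ 2 * (‖e ω‖ * (|δ| * ‖e ω‖)) := by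
            gcongr
            refine (abs_real_inner_le_norm _ _).trans ?_
            gcongr
            exact (hlip ω).trans (by gcongr; exact le_abs_self δ)
        _ = _ := by ring
    · have := mul_le_mul_of_nonneg_left (hmono ω) (sq_nonneg ‖e ω‖)
      calc _ ≤ _ := this
        _ = _ := by ring
  -- Young's inequality, weighted so that the mixed term costs one `ν` of the decay rate `4ν` coming
  -- from the first-order term. The remaining `3ν` is the rate in the conclusion, and the price is
  -- `16 / ν` times a term of order `mux²`.
  have hmix : 8 * mux * ∫ ω, ‖e ω‖ ^ 2 * ‖q ω + s ω‖ ^ 2 ∂P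
      ≤ ν * ∫ ω, ‖e ω‖ ^ 4 ∂P + 16 / ν * mux ^ 2 * ∫ ω, ‖q ω + s ω‖ ^ 4 ∂P := by
    have hegi : Integrable (fun ω => ‖e ω‖ ^ 2 * ‖q ω + s ω‖ ^ 2) P := by
      refine (he.add hgi).mono' ((me.norm.pow 2).mul
        ((h.meas_grad.mono h.le_ambient).norm.pow 2)).aestronglyMeasurable
        (ae_of_all _ fun ω => ?_)
      simp only [Pi.add_apply, norm_mul, norm_pow, norm_norm]
      nlinarith [sq_nonneg (‖e ω‖ ^ 2 - ‖q ω + s ω‖ ^ 2), sq_nonneg (‖e ω‖ ^ 2),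
        sq_nonneg (‖q ω + s ω‖ ^ 2)]
    rw [← integral_const_mul, ← integral_const_mul, ← integral_const_mul,
      ← integral_add (he.const_mul _) (hgi.const_mul _)]
    refine integral_mono (hegi.const_mul _) ((he.const_mul _).add (hgi.const_mul _)) fun ω => ?_
    have e1 := sq_nonneg (ν * ‖e ω‖ ^ 2 - 4 * mux * ‖q ω + s ω‖ ^ 2)
    have e2 : ν * ‖e ω‖ ^ 4 + 16 / ν * mux ^ 2 * ‖q ω + s ω‖ ^ 4
        - 8 * mux * (‖e ω‖ ^ 2 * ‖q ω + s ω‖ ^ 2)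
        = (ν * ‖e ω‖ ^ 2 - 4 * mux * ‖q ω + s ω‖ ^ 2) ^ 2 / ν := by
      field_simp; ring
    have e3 := div_nonneg e1 hν.le
    beta_reduce
    linarith
  have hgn : 0 ≤ ∫ ω, ‖q ω + s ω‖ ^ 4 ∂P := integral_nonneg fun ω => by positivity
  rw [h1, h2]
  have t1 := mul_le_mul_of_nonneg_left hcross hmubar
  have t2 := mul_le_mul_of_nonneg_left hmix hmubar
  have t3 := mul_le_mul_of_nonneg_right h4 hgn
  have t4 : mubar * mux ^ 2 * (16 / ν + 3 * ρ) * ∫ ω, ‖q ω + s ω‖ ^ 4 ∂P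
      ≤ mubar * mux ^ 2 * (16 / ν + 3 * ρ)
        * (8 * ((δ ^ 4 + b ^ 4) * ∫ ω, ‖e ω‖ ^ 4 ∂P + c)) := by gcongr
  linarith

end StochStep

/-- A bound on the conditional moment of order `k` of `s` bounds its moment on each set of the
conditioning σ-algebra. -/
theorem setIntegral_norm_pow_le_of_condLExp_le {Ω E : Type*} {F : MeasurableSpace Ω}
    [m : MeasurableSpace Ω] [NormedAddCommGroup E] {P : Measure Ω} [IsProbabilityMeasure P]
    (hF : F ≤ m) {s : Ω → E} (hs : AEStronglyMeasurable s P) {k : ℕ} {c : Ω → ℝ}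
    (hc0 : ∀ ω, 0 ≤ c ω)
    (h : ∀ᵐ ω ∂P, condLExp F P (fun ω' => ‖s ω'‖ₑ ^ k) ω ≤ ENNReal.ofReal (c ω))
    {B : Set Ω} (hB : MeasurableSet[F] B) (hc : IntegrableOn c B P) :
    IntegrableOn (fun ω => ‖s ω‖ ^ k) B P ∧
      ∫ ω in B, ‖s ω‖ ^ k ∂P ≤ ∫ ω in B, c ω ∂P := by
  have h1 : ∫⁻ ω in B, ‖s ω‖ₑ ^ k ∂P ≤ ∫⁻ ω in B, ENNReal.ofReal (c ω) ∂P := by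
    rw [← setLIntegral_condLExp hF P _ hB]
    exact lintegral_mono_ae (ae_restrict_of_ae h)
  have h2 : ∫⁻ ω in B, ENNReal.ofReal (c ω) ∂P ≠ ∞ := by
    rw [← ofReal_integral_eq_lintegral_ofReal hc (ae_of_all _ hc0)]
    exact ENNReal.ofReal_ne_top
  have h3 : ∀ ω, ‖‖s ω‖ ^ k‖ₑ = ‖s ω‖ₑ ^ k := fun ω => by rw [enorm_pow, enorm_norm]
  have hm : AEStronglyMeasurable (fun ω => ‖s ω‖ ^ k) (P.restrict B) := (hs.norm.pow k).restrict
  have hi : IntegrableOn (fun ω => ‖s ω‖ ^ k) B P := by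
    refine ⟨hm, ?_⟩
    rw [hasFiniteIntegral_iff_enorm]
    simp_rw [h3]
    exact h1.trans_lt h2.lt_top
  refine ⟨hi, ?_⟩
  rw [integral_eq_lintegral_of_nonneg_ae (ae_of_all _ fun ω => by positivity) hm,
    integral_eq_lintegral_of_nonneg_ae (ae_of_all _ hc0) hc.aestronglyMeasurable]
  refine ENNReal.toReal_mono h2 (le_trans (le_of_eq ?_) h1)
  refine lintegral_congr fun ω => ?_
  rw [← h3, Real.enorm_eq_ofReal (by positivity)]

/-! ### The algorithm as a sequence of stochastic steps, and its moment recursions. -/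

namespace AsyncSGD

variable {Ω : Type*} [m : MeasurableSpace Ω] {M : ℕ} {A : AsyncSGD Ω M}
  {P : Measure Ω} [IsProbabilityMeasure P] {J : EuclideanSpace ℝ (Fin M) → ℝ}
  {wo : EuclideanSpace ℝ (Fin M)} {ν δ β σs μub μbar σμ : ℝ} {Rs : Matrix (Fin M) (Fin M) ℝ}

/-- The σ-algebra of everything that determines the `i`-th update, except the step-size. -/
abbrev known (A : AsyncSGD Ω M) (i : ℕ) : MeasurableSpace Ω :=
  A.past i ⊔ ⨆ j : Fin (i + 1),
    MeasurableSpace.comap (fun ω => A.ghat j (A.iter j ω) ω) inferInstance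

theorem measurable_ghat_comp (A : AsyncSGD Ω M) (i : ℕ) {W : Ω → EuclideanSpace ℝ (Fin M)}
    (hW : Measurable W) : Measurable fun ω => A.ghat i (W ω) ω :=
  (A.measurable_ghat i).comp (hW.prodMk measurable_id)

theorem measurable_iter (A : AsyncSGD Ω M) (i : ℕ) : Measurable (A.iter i) := by
  induction i with
  | zero => exact A.measurable_init
  | succ i ih =>
    exact ih.sub ((A.measurable_step i).smul (A.measurable_ghat_comp i ih))

theorem past_le (A : AsyncSGD Ω M) (i : ℕ) : A.past i ≤ m :=
  iSup_le fun j => (A.measurable_iter j).comap_le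

theorem known_le (A : AsyncSGD Ω M) (i : ℕ) : A.known i ≤ m :=
  sup_le (A.past_le i)
    (iSup_le fun j => (A.measurable_ghat_comp j (A.measurable_iter j)).comap_le)

theorem measurable_iter_past (A : AsyncSGD Ω M) (i : ℕ) : Measurable[A.past i] (A.iter i) := by
  have h : MeasurableSpace.comap (A.iter (Fin.last i : Fin (i + 1))) inferInstance ≤ A.past i :=
    le_iSup (fun j : Fin (i + 1) => MeasurableSpace.comap (A.iter j) inferInstance) (Fin.last i)
  exact Measurable.of_comap_le h

/-- An event fixed by the initial point belongs to every past, so a recursion localized on it can be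
iterated without changing the event. -/
theorem past_zero_le (A : AsyncSGD Ω M) (i : ℕ) : A.past 0 ≤ A.past i := by
  refine iSup_le fun j => ?_
  have hj : (j : ℕ) = ((0 : Fin (i + 1)) : ℕ) := by simp
  rw [hj]
  exact le_iSup (fun j : Fin (i + 1) => MeasurableSpace.comap (A.iter j) inferInstance) 0

theorem measurable_ghat_known (A : AsyncSGD Ω M) (i : ℕ) :
    Measurable[A.known i] (fun ω => A.ghat i (A.iter i ω) ω) := by
  have h : MeasurableSpace.comap (fun ω => A.ghat (Fin.last i : Fin (i + 1))
      (A.iter (Fin.last i : Fin (i + 1)) ω) ω) inferInstance ≤ A.known i :=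
    (le_iSup (fun j : Fin (i + 1) => MeasurableSpace.comap (fun ω => A.ghat j (A.iter j ω) ω)
      inferInstance) (Fin.last i)).trans le_sup_right
  exact Measurable.of_comap_le h

theorem measurable_err_past (A : AsyncSGD Ω M) (wo : EuclideanSpace ℝ (Fin M)) (i : ℕ) :
    Measurable[A.past i] (A.err wo i) :=
  (measurable_id.const_sub wo).comp (A.measurable_iter_past i)

theorem measurable_err (A : AsyncSGD Ω M) (wo : EuclideanSpace ℝ (Fin M)) (i : ℕ) :
    Measurable (A.err wo i) := (A.measurable_err_past wo i).mono (A.past_le i) le_rfl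

theorem measurable_noise (A : AsyncSGD Ω M) (hJ : CostConditions J wo ν δ) (i : ℕ)
    {W : Ω → EuclideanSpace ℝ (Fin M)} (hW : Measurable W) :
    Measurable fun ω => A.noise J i (W ω) ω :=
  (A.measurable_ghat_comp i hW).sub (hJ.differentiable_gradient.continuous.measurable.comp hW)

theorem measurable_gradient_past (A : AsyncSGD Ω M) (hJ : CostConditions J wo ν δ) (i : ℕ) :
    Measurable[A.past i] fun ω => gradient J (A.iter i ω) :=
  hJ.differentiable_gradient.continuous.measurable.comp (A.measurable_iter_past i)

theorem norm_gradient_iter_le (hJ : CostConditions J wo ν δ) (i : ℕ) (ω : Ω) :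
    ‖gradient J (A.iter i ω)‖ ≤ δ * ‖A.err wo i ω‖ := by
  rw [err, norm_sub_rev]
  exact hJ.norm_gradient_le _

theorem inner_err_gradient_le (hJ : CostConditions J wo ν δ) (i : ℕ) (ω : Ω) :
    ⟪A.err wo i ω, gradient J (A.iter i ω)⟫ ≤ -ν * ‖A.err wo i ω‖ ^ 2 := by
  have h1 := hJ.le_inner_gradient (A.iter i ω)
  have h2 : A.err wo i ω = -(A.iter i ω - wo) := by simp [err]
  rw [h2, inner_neg_left, norm_neg]
  linarith

theorem err_succ (A : AsyncSGD Ω M) (J : EuclideanSpace ℝ (Fin M) → ℝ)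
    (wo : EuclideanSpace ℝ (Fin M)) (i : ℕ) (ω : Ω) :
    A.err wo (i + 1) ω = A.err wo i ω
      + A.step i ω • (gradient J (A.iter i ω) + A.noise J i (A.iter i ω) ω) := by
  simp only [err, iter, noise]
  rw [add_sub_cancel]
  abel

theorem noise_moment (hJ : CostConditions J wo ν δ) (hN : A.NoiseConditions P J wo β σs Rs)
    (i : ℕ) (he : MemLp (A.err wo i) 2 P) {B : Set Ω} (hB : MeasurableSet[A.past i] B) :
    IntegrableOn (fun ω => ‖A.noise J i (A.iter i ω) ω‖ ^ 2) B P ∧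
      ∫ ω in B, ‖A.noise J i (A.iter i ω) ω‖ ^ 2 ∂P
        ≤ β ^ 2 * ∫ ω in B, ‖A.err wo i ω‖ ^ 2 ∂P + P.real B * σs ^ 2 := by
  have hi := (he.integrable_norm_pow two_ne_zero).const_mul (β ^ 2)
  have hc : Integrable (fun ω => β ^ 2 * ‖A.err wo i ω‖ ^ 2 + σs ^ 2) P :=
    hi.add (integrable_const _)
  have h := setIntegral_norm_pow_le_of_condLExp_le (A.past_le i)
    (A.measurable_noise hJ i (A.measurable_iter i)).aestronglyMeasurable
    (fun ω => by positivity) (hN.second_moment i) hB hc.integrableOn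
  refine ⟨h.1, h.2.trans (le_of_eq ?_)⟩
  rw [integral_add hi.integrableOn (integrable_const _), integral_const_mul, setIntegral_const,
    smul_eq_mul]

theorem memLp_noise (hJ : CostConditions J wo ν δ) (hN : A.NoiseConditions P J wo β σs Rs)
    (i : ℕ) (he : MemLp (A.err wo i) 2 P) :
    MemLp (fun ω => A.noise J i (A.iter i ω) ω) 2 P := by
  have h := (noise_moment hJ hN i he (B := Set.univ) MeasurableSet.univ).1
  rw [integrableOn_univ] at h
  exact (memLp_two_iff_integrable_sq_norm
    (A.measurable_noise hJ i (A.measurable_iter i)).aestronglyMeasurable).mpr h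

/-- Square integrability of the error is left as a hypothesis here because `memLp_err` proves it by
induction, using this very step. -/
theorem stochStep_of_memLp (hJ : CostConditions J wo ν δ)
    (hN : A.NoiseConditions P J wo β σs Rs) (hS : A.StepConditions P μub μbar σμ) (i : ℕ)
    (he : MemLp (A.err wo i) 2 P) :
    StochStep (A.past i) (A.known i) P (A.step i) μub (A.err wo i)
      (fun ω => gradient J (A.iter i ω)) (fun ω => A.noise J i (A.iter i ω) ω) where
  le := le_sup_left
  le_ambient := A.known_le i
  meas_e := (A.measurable_err_past wo i).stronglyMeasurable
  meas_q := (A.measurable_gradient_past hJ i).stronglyMeasurable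
  meas_s := ((A.measurable_ghat_known i).sub
    ((A.measurable_gradient_past hJ i).mono le_sup_left le_rfl)).stronglyMeasurable
  meas_mu := A.measurable_step i
  mem_Icc := hS.mem_Icc i
  indep := hS.indep i
  memLp_e := he
  memLp_q := he.of_le_mul ((A.measurable_gradient_past hJ i).mono
    (A.past_le i) le_rfl).aestronglyMeasurable (ae_of_all _ fun ω => norm_gradient_iter_le hJ i ω)
  memLp_s := memLp_noise hJ hN i he
  mean_zero := hN.mean_zero i

theorem memLp_err (hJ : CostConditions J wo ν δ) (h0 : MemLp A.init 2 P)
    (hN : A.NoiseConditions P J wo β σs Rs) (hS : A.StepConditions P μub μbar σμ) (i : ℕ) :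
    MemLp (A.err wo i) 2 P := by
  induction i with
  | zero => exact (memLp_const wo).sub h0
  | succ i ih =>
    have := (stochStep_of_memLp hJ hN hS i ih).memLp_update
    simp_rw [← A.err_succ J wo i] at this
    exact this

theorem stochStep (hJ : CostConditions J wo ν δ) (h0 : MemLp A.init 2 P)
    (hN : A.NoiseConditions P J wo β σs Rs) (hS : A.StepConditions P μub μbar σμ) (i : ℕ) :
    StochStep (A.past i) (A.known i) P (A.step i) μub (A.err wo i)
      (fun ω => gradient J (A.iter i ω)) (fun ω => A.noise J i (A.iter i ω) ω) :=
  stochStep_of_memLp hJ hN hS i (memLp_err hJ h0 hN hS i)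

theorem integral_step_sq (hS : A.StepConditions P μub μbar σμ) (i : ℕ) :
    ∫ ω, A.step i ω ^ 2 ∂P = μbar ^ 2 + σμ ^ 2 := by
  have hm : MemLp (A.step i) ∞ P := by
    refine memLp_top_of_bound (A.measurable_step i).aestronglyMeasurable μub ?_
    filter_upwards [hS.mem_Icc i] with ω hω
    rw [Real.norm_eq_abs, abs_of_nonneg hω.1]
    exact hω.2
  have i1 : Integrable (A.step i) P := hm.integrable le_top
  have i2 : Integrable (fun ω => A.step i ω ^ 2) P := (hm.mono_exponent le_top).integrable_sq
  have h1 : ∀ ω, (A.step i ω - μbar) ^ 2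
      = A.step i ω ^ 2 - 2 * μbar * A.step i ω + μbar ^ 2 := fun ω => by ring
  have h2 := hS.variance i
  simp_rw [h1] at h2
  have i3 : Integrable (fun ω => A.step i ω ^ 2 - 2 * μbar * A.step i ω) P :=
    i2.sub (i1.const_mul _)
  rw [integral_add i3 (integrable_const _), integral_sub i2 (i1.const_mul _),
    integral_const_mul, hS.mean i] at h2
  simp at h2
  linarith

theorem indicator_err_succ (A : AsyncSGD Ω M) (J : EuclideanSpace ℝ (Fin M) → ℝ)
    (wo : EuclideanSpace ℝ (Fin M)) (i : ℕ) (B : Set Ω) (ω : Ω) :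
    B.indicator (A.err wo (i + 1)) ω = B.indicator (A.err wo i) ω
      + A.step i ω • (B.indicator (fun ω => gradient J (A.iter i ω)) ω
        + B.indicator (fun ω => A.noise J i (A.iter i ω) ω) ω) := by
  by_cases h : ω ∈ B <;> simp [h, A.err_succ J wo i ω]

theorem _root_.integral_norm_indicator_pow {Ω E : Type*} [MeasurableSpace Ω]
    [NormedAddCommGroup E] {P : Measure Ω} {B : Set Ω} (hB : MeasurableSet B) (f : Ω → E) {k : ℕ}
    (hk : k ≠ 0) :
    ∫ ω, ‖B.indicator f ω‖ ^ k ∂P = ∫ ω in B, ‖f ω‖ ^ k ∂P := by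
  rw [← integral_indicator hB]
  congr 1 with ω
  by_cases h : ω ∈ B <;> simp [h, hk]

theorem _root_.integrable_norm_indicator_pow_iff {Ω E : Type*} [MeasurableSpace Ω]
    [NormedAddCommGroup E] {P : Measure Ω} {B : Set Ω} (hB : MeasurableSet B) (f : Ω → E) {k : ℕ}
    (hk : k ≠ 0) :
    Integrable (fun ω => ‖B.indicator f ω‖ ^ k) P ↔ IntegrableOn (fun ω => ‖f ω‖ ^ k) B P := by
  rw [← integrable_indicator_iff hB]
  congr! 1
  ext ω
  by_cases h : ω ∈ B <;> simp [h, hk]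

/-- The mean-square recursion, localized on an event of the past. -/
theorem setIntegral_err_sq_succ_le (hJ : CostConditions J wo ν δ) (h0 : MemLp A.init 2 P)
    (hN : A.NoiseConditions P J wo β σs Rs) (hS : A.StepConditions P μub μbar σμ) (i : ℕ)
    {B : Set Ω} (hB : MeasurableSet[A.past i] B) :
    ∫ ω in B, ‖A.err wo (i + 1) ω‖ ^ 2 ∂P
      ≤ alphaAsyn ν δ β μbar σμ * ∫ ω in B, ‖A.err wo i ω‖ ^ 2 ∂P
        + (μbar ^ 2 + σμ ^ 2) * (P.real B * σs ^ 2) := by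
  have hBm := A.past_le i _ hB
  have h := (stochStep hJ h0 hN hS i).indicator hB
  have hn := (noise_moment hJ hN i (memLp_err hJ h0 hN hS i) hB).2
  rw [← integral_norm_indicator_pow hBm _ two_ne_zero,
    ← integral_norm_indicator_pow hBm _ two_ne_zero] at hn
  have h1 := h.integral_norm_sq_update_le (ν := ν) (δ := δ)
    (fun ω => by
      by_cases hω : ω ∈ B
      · simpa [hω] using inner_err_gradient_le hJ i ω
      · simp [hω])
    (fun ω => by
      by_cases hω : ω ∈ B
      · simpa [hω] using norm_gradient_iter_le hJ i ω
      · simp [hω]) hn (by rw [hS.mean i]; exact hS.mean_pos.le)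
  simp_rw [← A.indicator_err_succ J wo i B] at h1
  rw [integral_norm_indicator_pow hBm _ two_ne_zero,
    integral_norm_indicator_pow hBm _ two_ne_zero, hS.mean i, integral_step_sq hS i] at h1
  exact h1

theorem muX_pos (hμ : 0 < μbar) : 0 < muX μbar σμ := by
  unfold muX; positivity

/-- This is the second moment of the step-size. Written so, it shares the factor `μbar` with the
contraction rate, which is why the asymptotic bounds depend on `muX` alone. -/
theorem mul_muX (hμ : 0 < μbar) : μbar * muX μbar σμ = μbar ^ 2 + σμ ^ 2 := by
  unfold muX; field_simp

theorem le_muX (hμ : 0 < μbar) : μbar ≤ muX μbar σμ := by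
  unfold muX
  have : 0 ≤ σμ ^ 2 / μbar := by positivity
  linarith

/-- The fourth-order recursion, localized on an event of the past. -/
theorem setIntegral_err_pow_four_succ_le {β₄ σ₄ ρ : ℝ} (hJ : CostConditions J wo ν δ)
    (h0 : MemLp A.init 2 P)
    (hN : A.NoiseConditions P J wo β σs Rs) (hS : A.StepConditions P μub μbar σμ)
    (h4 : A.FourthMomentConditions P J wo β₄ σ₄ ρ μbar σμ) (i : ℕ)
    {B : Set Ω} (hB : MeasurableSet[A.past i] B)
    (he : IntegrableOn (fun ω => ‖A.err wo i ω‖ ^ 4) B P) :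
    IntegrableOn (fun ω => ‖A.err wo (i + 1) ω‖ ^ 4) B P ∧
    ∫ ω in B, ‖A.err wo (i + 1) ω‖ ^ 4 ∂P
      ≤ (1 - 3 * ν * μbar) * ∫ ω in B, ‖A.err wo i ω‖ ^ 4 ∂P
        + μbar * muX μbar σμ ^ 2 * (16 / ν + 3 * |ρ|)
          * (8 * ((δ ^ 4 + β₄ ^ 4) * ∫ ω in B, ‖A.err wo i ω‖ ^ 4 ∂P + σ₄ ^ 4)) := by
  have hBm := A.past_le i _ hB
  have h := (stochStep hJ h0 hN hS i).indicator hB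
  have hi := he.const_mul (β₄ ^ 4)
  have hc : IntegrableOn (fun ω => β₄ ^ 4 * ‖A.err wo i ω‖ ^ 4 + σ₄ ^ 4) B P :=
    hi.add (integrable_const _)
  have hβ : 0 ≤ β₄ ^ 4 := by positivity
  have hσ : 0 ≤ σ₄ ^ 4 := by positivity
  obtain ⟨hn1, hn2⟩ := setIntegral_norm_pow_le_of_condLExp_le (A.past_le i)
    (A.measurable_noise hJ i (A.measurable_iter i)).aestronglyMeasurable
    (fun ω => by positivity) (h4.noise_le i) hB hc
  have hn3 : ∫ ω in B, ‖A.noise J i (A.iter i ω) ω‖ ^ 4 ∂P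
      ≤ β₄ ^ 4 * ∫ ω in B, ‖A.err wo i ω‖ ^ 4 ∂P + σ₄ ^ 4 := by
    refine hn2.trans ?_
    rw [integral_add hi (integrable_const _), integral_const_mul, setIntegral_const, smul_eq_mul]
    have : P.real B * σ₄ ^ 4 ≤ 1 * σ₄ ^ 4 := mul_le_mul_of_nonneg_right measureReal_le_one hσ
    linarith
  rw [← integral_norm_indicator_pow hBm _ four_ne_zero,
    ← integral_norm_indicator_pow hBm _ four_ne_zero] at hn3
  rw [← integrable_norm_indicator_pow_iff hBm _ four_ne_zero] at hn1 he
  -- No sign of `ρ` is assumed, so its absolute value is used throughout.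
  have hρ : ∫ ω, A.step i ω ^ 4 ∂P ≤ |ρ| * μbar * muX μbar σμ ^ 2 :=
    (h4.step_le i).trans (by
      have := hS.mean_pos
      gcongr
      exact le_abs_self ρ)
  have h1 := h.integral_norm_pow_four_update_le (ν := ν) (δ := δ) hJ.pos
    (fun ω => by
      by_cases hω : ω ∈ B
      · simpa [hω] using inner_err_gradient_le hJ i ω
      · simp [hω])
    (fun ω => by
      by_cases hω : ω ∈ B
      · simpa [hω] using norm_gradient_iter_le hJ i ω
      · simp [hω]) he hn1 hn3 (hS.mean i)
    (by rw [integral_step_sq hS i, mul_muX hS.mean_pos]) hρ hS.mean_pos.le (abs_nonneg ρ)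
  simp_rw [← A.indicator_err_succ J wo i B] at h1
  rw [integral_norm_indicator_pow hBm _ four_ne_zero,
    integral_norm_indicator_pow hBm _ four_ne_zero,
    integrable_norm_indicator_pow_iff hBm _ four_ne_zero] at h1
  exact h1

end AsyncSGD

/-! ### Eventual bounds on second, fourth and truncated third moments. -/

namespace AsyncSGD

variable {Ω : Type*} [m : MeasurableSpace Ω] {M : ℕ} {A : AsyncSGD Ω M}
  {P : Measure Ω} [IsProbabilityMeasure P] {J : EuclideanSpace ℝ (Fin M) → ℝ}
  {wo : EuclideanSpace ℝ (Fin M)} {ν δ β σs μub μbar σμ : ℝ} {Rs : Matrix (Fin M) (Fin M) ℝ}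

theorem nu_mul_mean_le_one (hJ : CostConditions J wo ν δ) (hS : A.StepConditions P μub μbar σμ)
    (hμ : muX μbar σμ * (δ ^ 2 + β ^ 2) ≤ ν) : ν * μbar ≤ 1 := by
  have h1 := le_muX (σμ := σμ) hS.mean_pos
  have hν := hJ.pos
  have h2 : ν ^ 2 ≤ δ ^ 2 + β ^ 2 := by nlinarith [hJ.le, sq_nonneg β]
  have h3 := muX_pos (σμ := σμ) hS.mean_pos
  have h4 : muX μbar σμ * ν ^ 2 ≤ ν := (mul_le_mul_of_nonneg_left h2 h3.le).trans hμ
  have h5 : ν * (ν * muX μbar σμ) ≤ ν * 1 := by linarith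
  have h6 := le_of_mul_le_mul_left h5 hν
  nlinarith

/-- Under `hμ` the quadratic part of `alphaAsyn` uses up at most half of `2ν μbar`, leaving the rate
`ν μbar`. The bound is proportional to the probability of `B`, which is what makes rare events
negligible. -/
theorem eventually_setIntegral_err_sq_le (hJ : CostConditions J wo ν δ) (h0 : MemLp A.init 2 P)
    (hN : A.NoiseConditions P J wo β σs Rs) (hS : A.StepConditions P μub μbar σμ)
    (hμ : muX μbar σμ * (δ ^ 2 + β ^ 2) ≤ ν) {B : Set Ω} (hB : MeasurableSet[A.past 0] B) {c : ℝ}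
    (hc : muX μbar σμ * (P.real B * σs ^ 2) / ν < c) :
    ∀ᶠ i in atTop, ∫ ω in B, ‖A.err wo i ω‖ ^ 2 ∂P ≤ c := by
  have hν := hJ.pos
  have hb := hS.mean_pos
  refine eventually_le_of_le_contraction (a := ν * μbar)
    (b := (μbar ^ 2 + σμ ^ 2) * (P.real B * σs ^ 2)) (by positivity)
    (nu_mul_mean_le_one hJ hS hμ) ?_ (Eventually.of_forall fun i => ?_)
  · rw [← mul_muX hb]
    refine lt_of_eq_of_lt ?_ hc
    field_simp
  · refine (setIntegral_err_sq_succ_le hJ h0 hN hS i (A.past_zero_le i _ hB)).trans ?_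
    gcongr
    unfold alphaAsyn
    rw [← mul_muX hb]
    have := mul_le_mul_of_nonneg_left hμ hb.le
    linarith

theorem eventually_setIntegral_err_pow_four_le {β₄ σ₄ ρ : ℝ} (hJ : CostConditions J wo ν δ)
    (h0 : MemLp A.init 2 P)
    (hN : A.NoiseConditions P J wo β σs Rs) (hS : A.StepConditions P μub μbar σμ)
    (h4 : A.FourthMomentConditions P J wo β₄ σ₄ ρ μbar σμ)
    (hμ : muX μbar σμ * (δ ^ 2 + β ^ 2) ≤ ν)
    (hμ4 : muX μbar σμ ^ 2 * (8 * (16 / ν + 3 * |ρ|) * (δ ^ 4 + β₄ ^ 4)) ≤ ν)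
    {B : Set Ω} (hB : MeasurableSet[A.past 0] B)
    (he : IntegrableOn (fun ω => ‖A.err wo 0 ω‖ ^ 4) B P) :
    (∀ i, IntegrableOn (fun ω => ‖A.err wo i ω‖ ^ 4) B P) ∧
    ∀ᶠ i in atTop, ∫ ω in B, ‖A.err wo i ω‖ ^ 4 ∂P
      ≤ (8 * (16 / ν + 3 * |ρ|) * σ₄ ^ 4 / ν + 1) * muX μbar σμ ^ 2 := by
  have hν := hJ.pos
  have hb := hS.mean_pos
  have hx := muX_pos (σμ := σμ) hb
  have hi : ∀ i, IntegrableOn (fun ω => ‖A.err wo i ω‖ ^ 4) B P := by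
    intro i
    induction i with
    | zero => exact he
    | succ i ih =>
      exact (setIntegral_err_pow_four_succ_le hJ h0 hN hS h4 i (A.past_zero_le i _ hB) ih).1
  refine ⟨hi, ?_⟩
  refine eventually_le_of_le_contraction (a := ν * μbar)
    (b := μbar * muX μbar σμ ^ 2 * (16 / ν + 3 * |ρ|) * (8 * σ₄ ^ 4)) (by positivity)
    (nu_mul_mean_le_one hJ hS hμ) ?_ (Eventually.of_forall fun i => ?_)
  · have : μbar * muX μbar σμ ^ 2 * (16 / ν + 3 * |ρ|) * (8 * σ₄ ^ 4) / (ν * μbar)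
        = 8 * (16 / ν + 3 * |ρ|) * σ₄ ^ 4 / ν * muX μbar σμ ^ 2 := by
      field_simp
    rw [this]
    nlinarith [pow_pos hx 2]
  · have h1 := (setIntegral_err_pow_four_succ_le hJ h0 hN hS h4 i (A.past_zero_le i _ hB) (hi i)).2
    have h2 : 0 ≤ ∫ ω in B, ‖A.err wo i ω‖ ^ 4 ∂P := integral_nonneg fun ω => by positivity
    -- The moment-dependent part of the perturbation is absorbed in one `ν μbar`; of the `2ν μbar`
    -- left, only `ν μbar` is used.
    have h3 := mul_le_mul_of_nonneg_right (mul_le_mul_of_nonneg_left hμ4 hb.le) h2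
    have h5 : 0 ≤ ν * μbar * ∫ ω in B, ‖A.err wo i ω‖ ^ 4 ∂P := by positivity
    linarith

/-- Truncating at a high level of the initial error makes the fourth-order estimates available
although the initial error is only square integrable. -/
theorem eventually_integral_min_err_le {β₄ σ₄ ρ t : ℝ} (hJ : CostConditions J wo ν δ)
    (h0 : MemLp A.init 2 P)
    (hN : A.NoiseConditions P J wo β σs Rs) (hS : A.StepConditions P μub μbar σμ)
    (h4 : A.FourthMomentConditions P J wo β₄ σ₄ ρ μbar σμ)
    (hμ : muX μbar σμ * (δ ^ 2 + β ^ 2) ≤ ν)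
    (hμ4 : muX μbar σμ ^ 2 * (8 * (16 / ν + 3 * |ρ|) * (δ ^ 4 + β₄ ^ 4)) ≤ ν)
    (ht : 0 < t) (htμ : muX μbar σμ = t ^ 2) :
    ∀ᶠ i in atTop, ∫ ω, min (‖A.err wo i ω‖ ^ 2) (‖A.err wo i ω‖ ^ 3) ∂P
      ≤ ((8 * (16 / ν + 3 * |ρ|) * σ₄ ^ 4 / ν + 1) + 2 * (σs ^ 2 / ν + 1)) * t ^ 3 := by
  have hν := hJ.pos
  have hint := fun i => (memLp_err hJ h0 hN hS i).integrable_norm_pow two_ne_zero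
  set I := ∫ ω, ‖A.err wo 0 ω‖ ^ 2 ∂P with hI
  have hI0 : 0 ≤ I := integral_nonneg fun ω => sq_nonneg _
  -- Chosen so that Markov's inequality gives `P(D) ≤ I / ε ≤ t`. The level depends on the initial
  -- condition, but only through the transient, which the eventual bounds forget.
  set ε := (I + 1) / t with hε
  have hε0 : 0 < ε := by positivity
  set D := {ω | ε ≤ ‖A.err wo 0 ω‖ ^ 2} with hD
  have hmD : MeasurableSet[A.past 0] D :=
    A.measurable_err_past wo 0 (measurableSet_le measurable_const (measurable_norm.pow_const 2))
  have hmB : MeasurableSet[A.past 0] Dᶜ := hmD.compl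
  have hPD : P.real D ≤ t := by
    have h1 : ε * P.real D ≤ I :=
      mul_meas_ge_le_integral_of_nonneg (ae_of_all _ fun ω => sq_nonneg _) (hint 0) ε
    have h2 : ε * t = I + 1 := by rw [hε]; field_simp
    have h3 : ε * P.real D ≤ ε * t := by linarith
    exact le_of_mul_le_mul_left h3 hε0
  have he : IntegrableOn (fun ω => ‖A.err wo 0 ω‖ ^ 4) Dᶜ P := by
    refine Measure.integrableOn_of_bounded (M := ε ^ 2) (measure_ne_top _ _)
      ((A.measurable_err wo 0).norm.pow_const 4).aestronglyMeasurable ?_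
    refine (ae_restrict_iff' (A.past_le 0 _ hmB)).mpr (ae_of_all _ fun ω hω => ?_)
    have hω' : ‖A.err wo 0 ω‖ ^ 2 < ε := by simpa [hD] using hω
    rw [norm_pow, norm_norm]
    calc ‖A.err wo 0 ω‖ ^ 4 = (‖A.err wo 0 ω‖ ^ 2) ^ 2 := by ring
      _ ≤ ε ^ 2 := by gcongr
  obtain ⟨hi4, hev4⟩ := eventually_setIntegral_err_pow_four_le hJ h0 hN hS h4 hμ hμ4 hmB he
  have hev2 := eventually_setIntegral_err_sq_le hJ h0 hN hS hμ hmB (c := (σs ^ 2 / ν + 1) * t ^ 2)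
    (by
      rw [htμ]
      have h1 : P.real Dᶜ * σs ^ 2 ≤ 1 * σs ^ 2 := by gcongr; exact measureReal_le_one
      calc t ^ 2 * (P.real Dᶜ * σs ^ 2) / ν ≤ t ^ 2 * (1 * σs ^ 2) / ν := by gcongr
        _ = σs ^ 2 / ν * t ^ 2 := by ring
        _ < _ := by nlinarith [pow_pos ht 2])
  have hevD := eventually_setIntegral_err_sq_le hJ h0 hN hS hμ hmD (c := (σs ^ 2 / ν + 1) * t ^ 3)
    (by
      rw [htμ]
      calc t ^ 2 * (P.real D * σs ^ 2) / ν ≤ t ^ 2 * (t * σs ^ 2) / ν := by gcongr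
        _ = σs ^ 2 / ν * t ^ 3 := by ring
        _ < _ := by nlinarith [pow_pos ht 3])
  filter_upwards [hev4, hev2, hevD] with i e4 e2 eD
  have hmin : Integrable (fun ω => min (‖A.err wo i ω‖ ^ 2) (‖A.err wo i ω‖ ^ 3)) P := by
    refine (hint i).mono' (((A.measurable_err wo i).norm.pow_const 2).min
      ((A.measurable_err wo i).norm.pow_const 3)).aestronglyMeasurable (ae_of_all _ fun ω => ?_)
    rw [Real.norm_eq_abs, abs_of_nonneg (by positivity)]
    exact min_le_left _ _
  rw [← integral_add_compl (A.past_le 0 _ hmD) hmin]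
  have p1 : ∫ ω in D, min (‖A.err wo i ω‖ ^ 2) (‖A.err wo i ω‖ ^ 3) ∂P
      ≤ (σs ^ 2 / ν + 1) * t ^ 3 :=
    (integral_mono hmin.integrableOn (hint i).integrableOn fun ω => min_le_left _ _).trans eD
  -- Interpolation `x³ ≤ x⁴ / t + t x²`: with fourth moment `O(t⁴)` and second moment `O(t²)`, both
  -- terms are `O(t³)`.
  have p2 : ∫ ω in Dᶜ, min (‖A.err wo i ω‖ ^ 2) (‖A.err wo i ω‖ ^ 3) ∂P
      ≤ 1 / t * ∫ ω in Dᶜ, ‖A.err wo i ω‖ ^ 4 ∂P + t * ∫ ω in Dᶜ, ‖A.err wo i ω‖ ^ 2 ∂P := by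
    have j4 := (hi4 i).const_mul (1 / t)
    have j2 := (hint i).integrableOn (s := Dᶜ) |>.const_mul t
    rw [← integral_const_mul, ← integral_const_mul, ← integral_add j4 j2]
    refine integral_mono hmin.integrableOn (j4.add j2) fun ω => (min_le_right _ _).trans ?_
    set x := ‖A.err wo i ω‖
    have h1 : 1 / t * x ^ 4 + t * x ^ 2 - x ^ 3
        = ((x ^ 2 - t * x / 2) ^ 2 + 3 / 4 * (t * x) ^ 2) / t := by
      field_simp; ring
    have h2 : 0 ≤ ((x ^ 2 - t * x / 2) ^ 2 + 3 / 4 * (t * x) ^ 2) / t := by positivity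
    linarith
  have p3 : 1 / t * ∫ ω in Dᶜ, ‖A.err wo i ω‖ ^ 4 ∂P
      ≤ (8 * (16 / ν + 3 * |ρ|) * σ₄ ^ 4 / ν + 1) * t ^ 3 := by
    rw [htμ] at e4
    calc _ ≤ 1 / t * ((8 * (16 / ν + 3 * |ρ|) * σ₄ ^ 4 / ν + 1) * (t ^ 2) ^ 2) := by gcongr
      _ = _ := by field_simp
  have p4 := mul_le_mul_of_nonneg_left e2 ht.le
  linarith

theorem eventually_integral_err_sq_le {t : ℝ} (hJ : CostConditions J wo ν δ)
    (h0 : MemLp A.init 2 P)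
    (hN : A.NoiseConditions P J wo β σs Rs) (hS : A.StepConditions P μub μbar σμ)
    (hμ : muX μbar σμ * (δ ^ 2 + β ^ 2) ≤ ν) (ht : 0 < t) (htμ : muX μbar σμ = t ^ 2) :
    ∀ᶠ i in atTop, ∫ ω, ‖A.err wo i ω‖ ^ 2 ∂P ≤ (σs ^ 2 / ν + 1) * t ^ 2 := by
  have := eventually_setIntegral_err_sq_le hJ h0 hN hS hμ (B := Set.univ) MeasurableSet.univ
    (c := (σs ^ 2 / ν + 1) * t ^ 2) (by
      rw [htμ]
      simp only [probReal_univ, one_mul]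
      have : t ^ 2 * σs ^ 2 / ν = σs ^ 2 / ν * t ^ 2 := by ring
      nlinarith [pow_pos ht 2])
  simpa using this

end AsyncSGD

/-! ### The gradient-noise covariance along a fixed direction. -/

open scoped Matrix.Norms.L2Operator in
theorem abs_dotProduct_mulVec_le {M : ℕ} (R : Matrix (Fin M) (Fin M) ℝ)
    {u : EuclideanSpace ℝ (Fin M)} (hu : ‖u‖ = 1) : |u.ofLp ⬝ᵥ R.mulVec u.ofLp| ≤ ‖R‖ := by
  rw [← Matrix.inner_toEuclideanCLM, Matrix.cstar_norm_def]
  refine (abs_real_inner_le_norm _ _).trans ?_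
  have := (Matrix.toEuclideanCLM (𝕜 := ℝ) R).le_opNorm u
  rw [hu] at this ⊢
  linarith

namespace AsyncSGD

variable {Ω : Type*} [m : MeasurableSpace Ω] {M : ℕ} {A : AsyncSGD Ω M}
  {P : Measure Ω} [IsProbabilityMeasure P] {J : EuclideanSpace ℝ (Fin M) → ℝ}
  {wo u : EuclideanSpace ℝ (Fin M)} {ν δ β σs μub μbar σμ τ₂ κ r : ℝ}
  {Rs : Matrix (Fin M) (Fin M) ℝ}

/-- The quadratic form is a finite combination of entries, so linearity of the conditional
expectation applies; square integrability makes every entry integrable. -/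
theorem condCov_quadForm (A : AsyncSGD Ω M) (P : Measure Ω) (J : EuclideanSpace ℝ (Fin M) → ℝ)
    (u : EuclideanSpace ℝ (Fin M)) (i : ℕ) {W : Ω → EuclideanSpace ℝ (Fin M)}
    (hW : MemLp (fun ω => A.noise J i (W ω) ω) 2 P) :
    (fun ω => u.ofLp ⬝ᵥ (A.condCov P J i W ω).mulVec u.ofLp)
      =ᵐ[P] P[fun ω => ⟪u, A.noise J i (W ω) ω⟫ ^ 2 | A.past i] := by
  have hc : ∀ a, MemLp (fun ω => A.noise J i (W ω) ω a) 2 P := fun a =>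
    (EuclideanSpace.proj (𝕜 := ℝ) a).comp_memLp' hW
  have hi : ∀ a b, Integrable (fun ω => A.noise J i (W ω) ω a * A.noise J i (W ω) ω b) P :=
    fun a b => (hc a).integrable_mul (hc b)
  have h1 : (fun ω => ⟪u, A.noise J i (W ω) ω⟫ ^ 2)
      = ∑ p : Fin M × Fin M, (u p.1 * u p.2) •
          fun ω => A.noise J i (W ω) ω p.1 * A.noise J i (W ω) ω p.2 := by
    ext ω
    simp only [Finset.sum_apply, Pi.smul_apply, smul_eq_mul, PiLp.inner_apply, sq,
      Finset.sum_mul_sum, Fintype.sum_prod_type]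
    refine Finset.sum_congr rfl fun a _ => Finset.sum_congr rfl fun b _ => ?_
    simp
    ring
  rw [h1]
  have h2 := condExp_finsetSum (μ := P) (s := Finset.univ)
    (f := fun p : Fin M × Fin M => (u p.1 * u p.2) •
      fun ω => A.noise J i (W ω) ω p.1 * A.noise J i (W ω) ω p.2)
    (fun p _ => (hi p.1 p.2).smul _) (A.past i)
  have h3 : ∀ᵐ ω ∂P, ∀ p : Fin M × Fin M, P[(u p.1 * u p.2) •
      fun ω => A.noise J i (W ω) ω p.1 * A.noise J i (W ω) ω p.2 | A.past i] ω
      = (u p.1 * u p.2) * A.condCov P J i W ω p.1 p.2 := by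
    rw [ae_all_iff]
    intro p
    filter_upwards [condExp_smul (μ := P) (u p.1 * u p.2)
      (fun ω => A.noise J i (W ω) ω p.1 * A.noise J i (W ω) ω p.2) (A.past i)] with ω hω
    rw [hω]
    rfl
  filter_upwards [h2, h3] with ω e2 e3
  rw [e2, Finset.sum_apply]
  simp_rw [e3]
  simp only [dotProduct, Matrix.mulVec, Finset.mul_sum, Fintype.sum_prod_type]
  refine Finset.sum_congr rfl fun a _ => Finset.sum_congr rfl fun b _ => ?_
  ring

theorem CovLipschitzAt.abs_quadForm_sub_le (h : A.CovLipschitzAt P J wo τ₂ κ r) (hu : ‖u‖ = 1)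
    (i : ℕ) {dw : Ω → EuclideanSpace ℝ (Fin M)} (hdw : Measurable[A.past i] dw)
    (hr : ∀ ω, ‖dw ω‖ ≤ r) (hL : MemLp (fun ω => A.noise J i (wo + dw ω) ω) 2 P) :
    ∀ᵐ ω ∂P, |u.ofLp ⬝ᵥ (A.condCov P J i (fun ω' => wo + dw ω') ω).mulVec u.ofLp
        - u.ofLp ⬝ᵥ (A.condCov P J i (fun _ => wo) ω).mulVec u.ofLp| ≤ τ₂ * ‖dw ω‖ ^ κ := by
  filter_upwards [h i dw hdw hr hL] with ω hω
  rw [← dotProduct_sub, ← Matrix.sub_mulVec]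
  exact (abs_dotProduct_mulVec_le _ hu).trans hω

/-- The displacement from the minimizer to the iterate, set to zero outside the ball of
radius `r`. -/
noncomputable def truncDisp (A : AsyncSGD Ω M) (wo : EuclideanSpace ℝ (Fin M)) (r : ℝ) (i : ℕ) :
    Ω → EuclideanSpace ℝ (Fin M) :=
  {ω | ‖A.err wo i ω‖ ≤ r}.indicator fun ω => -A.err wo i ω

theorem measurableSet_near (A : AsyncSGD Ω M) (wo : EuclideanSpace ℝ (Fin M)) (r : ℝ) (i : ℕ) :
    MeasurableSet[A.past i] {ω | ‖A.err wo i ω‖ ≤ r} :=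
  A.measurable_err_past wo i (measurableSet_le measurable_norm measurable_const)

theorem measurable_truncDisp (A : AsyncSGD Ω M) (wo : EuclideanSpace ℝ (Fin M)) (r : ℝ) (i : ℕ) :
    Measurable[A.past i] (A.truncDisp wo r i) :=
  Measurable.indicator (measurable_neg.comp (A.measurable_err_past wo i))
    (A.measurableSet_near wo r i)

theorem norm_truncDisp_le (A : AsyncSGD Ω M) (wo : EuclideanSpace ℝ (Fin M)) (hr : 0 < r) (i : ℕ)
    (ω : Ω) : ‖A.truncDisp wo r i ω‖ ≤ r := by
  unfold truncDisp
  by_cases h : ω ∈ {ω | ‖A.err wo i ω‖ ≤ r}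
  · rw [Set.indicator_of_mem h, norm_neg]; exact h
  · rw [Set.indicator_of_notMem h, norm_zero]; exact hr.le

theorem noise_truncDisp (A : AsyncSGD Ω M) (J : EuclideanSpace ℝ (Fin M) → ℝ)
    {wo : EuclideanSpace ℝ (Fin M)} {r : ℝ} {i : ℕ} {ω : Ω} (h : ‖A.err wo i ω‖ ≤ r) :
    A.noise J i (wo + A.truncDisp wo r i ω) ω = A.noise J i (A.iter i ω) ω := by
  have h1 : ω ∈ {ω | ‖A.err wo i ω‖ ≤ r} := h
  rw [truncDisp, Set.indicator_of_mem h1]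
  simp [err]

/-- The evaluation point is the iterate inside the ball and `wo` outside it, and the noise is square
integrable at both. -/
theorem memLp_noise_truncDisp (hJ : CostConditions J wo ν δ) (h0 : MemLp A.init 2 P)
    (hN : A.NoiseConditions P J wo β σs Rs) (hS : A.StepConditions P μub μbar σμ) (r : ℝ) (i : ℕ) :
    MemLp (fun ω => A.noise J i (wo + A.truncDisp wo r i ω) ω) 2 P := by
  have hm := A.past_le i _ (A.measurableSet_near wo r i)
  have h1 := ((stochStep hJ h0 hN hS i).memLp_s.indicator hm).add
    ((hN.memLp_minimizer i).indicator hm.compl)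
  refine h1.ae_eq (ae_of_all _ fun ω => Eq.symm ?_)
  by_cases h : ω ∈ {ω | ‖A.err wo i ω‖ ≤ r}
  · simp only [Pi.add_apply]
    rw [A.noise_truncDisp J h]
    rw [Set.indicator_of_mem h, Set.indicator_of_notMem (Set.notMem_compl_iff.mpr h), add_zero]
  · simp only [Pi.add_apply]
    rw [truncDisp, Set.indicator_of_notMem h, Set.indicator_of_notMem h,
      Set.indicator_of_mem (Set.mem_compl h), add_zero, zero_add]

theorem inner_sq_le (hu : ‖u‖ = 1) (x : EuclideanSpace ℝ (Fin M)) : ⟪u, x⟫ ^ 2 ≤ ‖x‖ ^ 2 := by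
  rw [← sq_abs]
  refine pow_le_pow_left₀ (abs_nonneg _) ?_ 2
  simpa [hu] using abs_real_inner_le_norm u x

theorem integrable_inner_sq {f : Ω → EuclideanSpace ℝ (Fin M)} (hf : MemLp f 2 P)
    (u : EuclideanSpace ℝ (Fin M)) : Integrable (fun ω => ⟪u, f ω⟫ ^ 2) P :=
  ((innerSL ℝ u).comp_memLp' hf).integrable_sq

theorem condExp_inner_noise_sq_le (hJ : CostConditions J wo ν δ) (h0 : MemLp A.init 2 P)
    (hN : A.NoiseConditions P J wo β σs Rs) (hS : A.StepConditions P μub μbar σμ)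
    (hu : ‖u‖ = 1) (i : ℕ) :
    ∀ᵐ ω ∂P, P[fun ω => ⟪u, A.noise J i (A.iter i ω) ω⟫ ^ 2 | A.past i] ω
      ≤ β ^ 2 * ‖A.err wo i ω‖ ^ 2 + σs ^ 2 := by
  have hs := (stochStep hJ h0 hN hS i).memLp_s
  have hsi := hs.integrable_norm_pow two_ne_zero
  have h1 := condExp_mono (m := A.past i) (integrable_inner_sq hs u) hsi
    (ae_of_all _ fun ω => inner_sq_le hu _)
  have h2 := condLExp_ofReal (A.past i) hsi (ae_of_all _ fun ω => sq_nonneg _)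
  have h3 : (fun ω => ENNReal.ofReal (‖A.noise J i (A.iter i ω) ω‖ ^ 2))
      = fun ω => ‖A.noise J i (A.iter i ω) ω‖ₑ ^ 2 := by
    ext ω
    rw [ENNReal.ofReal_pow (norm_nonneg _), ofReal_norm]
  rw [h3] at h2
  filter_upwards [h1, h2, hN.second_moment i] with ω e1 e2 e3
  rw [e2] at e3
  exact e1.trans ((ENNReal.ofReal_le_ofReal_iff (by positivity)).mp e3)

/-- On a bounded range any exponent in `[1, 2]` is as good as a linear bound, so only the first
moment of the error matters later. -/
theorem rpow_le_of_le {x : ℝ} (hx : 0 ≤ x) (hxr : x ≤ r) (hκ : κ ∈ Set.Icc (1 : ℝ) 2) :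
    x ^ κ ≤ (1 + r) * x := by
  rcases hx.eq_or_lt with rfl | hx0
  · rw [Real.zero_rpow (by linarith [hκ.1])]; simp
  rcases le_total x 1 with h1 | h1
  · calc x ^ κ ≤ x ^ (1 : ℝ) := Real.rpow_le_rpow_of_exponent_ge hx0 h1 hκ.1
      _ = x := Real.rpow_one x
      _ ≤ _ := by nlinarith
  · calc x ^ κ ≤ x ^ (2 : ℝ) := Real.rpow_le_rpow_of_exponent_le h1 hκ.2
      _ = x ^ 2 := Real.rpow_two x
      _ ≤ _ := by nlinarith

/-- The conditional covariance form at the minimizer is bounded on the event that the iterate is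
near the minimizer, although no moment bound is assumed at the minimizer itself. -/
theorem abs_quadForm_minimizer_le (hJ : CostConditions J wo ν δ) (h0 : MemLp A.init 2 P)
    (hN : A.NoiseConditions P J wo β σs Rs) (hS : A.StepConditions P μub μbar σμ)
    (hL : A.CovLipschitzAt P J wo τ₂ κ r) (hr : 0 < r) (hτ₂ : 0 ≤ τ₂)
    (hκ : κ ∈ Set.Icc (1 : ℝ) 2) (hu : ‖u‖ = 1) (i : ℕ) :
    ∀ᵐ ω ∂P, ‖A.err wo i ω‖ ≤ r →
      |u.ofLp ⬝ᵥ (A.condCov P J i (fun _ => wo) ω).mulVec u.ofLp|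
        ≤ β ^ 2 * r ^ 2 + σs ^ 2 + τ₂ * ((1 + r) * r) := by
  have hs := (stochStep hJ h0 hN hS i).memLp_s
  have hs' := memLp_noise_truncDisp hJ h0 hN hS r i
  have hmS := A.measurableSet_near wo r i
  have c1 := condExp_indicator (integrable_inner_sq hs u) hmS
  have c2 := condExp_indicator (integrable_inner_sq hs' u) hmS
  -- The noise at the truncated point and at the iterate agree on an event of the past, so their
  -- conditional second moments agree there too. The moment bound at the iterate thereby reaches the
  -- minimizer through the Lipschitz condition.
  have c3 : {ω | ‖A.err wo i ω‖ ≤ r}.indicator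
        (fun ω => ⟪u, A.noise J i (wo + A.truncDisp wo r i ω) ω⟫ ^ 2)
      = {ω | ‖A.err wo i ω‖ ≤ r}.indicator (fun ω => ⟪u, A.noise J i (A.iter i ω) ω⟫ ^ 2) := by
    refine Set.indicator_congr fun ω hω => ?_
    rw [A.noise_truncDisp J hω]
  rw [c3] at c2
  have c4 := condExp_nonneg (m := A.past i) (μ := P)
    (f := fun ω => ⟪u, A.noise J i (wo + A.truncDisp wo r i ω) ω⟫ ^ 2)
    (ae_of_all _ fun ω => sq_nonneg _)
  filter_upwards [c1, c2, c4, condExp_inner_noise_sq_le hJ h0 hN hS hu i,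
    A.condCov_quadForm P J u i hs', hL.abs_quadForm_sub_le hu i (A.measurable_truncDisp wo r i)
      (A.norm_truncDisp_le wo hr i) hs'] with ω e1 e2 e4 e5 e6 e7 hω
  have hω' : ω ∈ {ω | ‖A.err wo i ω‖ ≤ r} := hω
  rw [e1, Set.indicator_of_mem hω', Set.indicator_of_mem hω'] at e2
  rw [e6, ← e2] at e7
  rw [← e2] at e4
  have e8 : ‖A.truncDisp wo r i ω‖ ^ κ ≤ (1 + r) * r :=
    (rpow_le_of_le (norm_nonneg _) (A.norm_truncDisp_le wo hr i ω) hκ).trans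
      (by gcongr; exact A.norm_truncDisp_le wo hr i ω)
  have e9 := mul_le_mul_of_nonneg_left e8 hτ₂
  have e10 : β ^ 2 * ‖A.err wo i ω‖ ^ 2 ≤ β ^ 2 * r ^ 2 := by gcongr
  have e11 := abs_le.mp e7
  simp only [Pi.zero_apply] at e4
  rw [abs_le]
  constructor <;> nlinarith [sq_nonneg (β * r), sq_nonneg σs]

theorem aestronglyMeasurable_quadForm_minimizer (hN : A.NoiseConditions P J wo β σs Rs) (i : ℕ) :
    AEStronglyMeasurable
      (fun ω => u.ofLp ⬝ᵥ (A.condCov P J i (fun _ => wo) ω).mulVec u.ofLp) P :=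
  (stronglyMeasurable_condExp.mono (A.past_le i)).aestronglyMeasurable.congr
    (A.condCov_quadForm P J u i (hN.memLp_minimizer i)).symm

/-- Dominated convergence, with the constant from `abs_quadForm_minimizer_le`. The indicator is
essential to the domination: at `wo` itself the second moments are assumed finite, but not uniformly
bounded. -/
theorem tendsto_integral_quadForm_minimizer (hJ : CostConditions J wo ν δ)
    (h0 : MemLp A.init 2 P)
    (hN : A.NoiseConditions P J wo β σs Rs) (hS : A.StepConditions P μub μbar σμ)
    (hL : A.CovLipschitzAt P J wo τ₂ κ r) (hr : 0 < r) (hτ₂ : 0 ≤ τ₂)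
    (hκ : κ ∈ Set.Icc (1 : ℝ) 2) (hu : ‖u‖ = 1) :
    Tendsto (fun i => ∫ ω, {ω | ‖A.err wo i ω‖ ≤ r}.indicator (fun ω =>
      u.ofLp ⬝ᵥ (A.condCov P J i (fun _ => wo) ω).mulVec u.ofLp
        - u.ofLp ⬝ᵥ Rs.mulVec u.ofLp) ω ∂P) atTop (𝓝 0) := by
  have hcont : Continuous fun R : Matrix (Fin M) (Fin M) ℝ => u.ofLp ⬝ᵥ R.mulVec u.ofLp := by
    fun_prop
  rw [← integral_zero Ω ℝ (μ := P)]
  refine tendsto_integral_of_dominated_convergence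
    (fun _ => β ^ 2 * r ^ 2 + σs ^ 2 + τ₂ * ((1 + r) * r) + |u.ofLp ⬝ᵥ Rs.mulVec u.ofLp|)
    (fun i => ((aestronglyMeasurable_quadForm_minimizer hN i).sub
      aestronglyMeasurable_const).indicator (A.past_le i _ (A.measurableSet_near wo r i)))
    (integrable_const _) (fun i => ?_) ?_
  · filter_upwards [abs_quadForm_minimizer_le hJ h0 hN hS hL hr hτ₂ hκ hu i] with ω hω
    by_cases h : ω ∈ {ω | ‖A.err wo i ω‖ ≤ r}
    · rw [Set.indicator_of_mem h, Real.norm_eq_abs]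
      exact (abs_sub _ _).trans (by linarith [hω h])
    · rw [Set.indicator_of_notMem h, norm_zero]
      positivity
  · filter_upwards [hN.tendsto_cov] with ω hω
    have h1 : Tendsto (fun i => |u.ofLp ⬝ᵥ (A.condCov P J i (fun _ => wo) ω).mulVec u.ofLp
        - u.ofLp ⬝ᵥ Rs.mulVec u.ofLp|) atTop (𝓝 0) := by
      have := ((hcont.tendsto Rs).comp hω).sub_const (u.ofLp ⬝ᵥ Rs.mulVec u.ofLp)
      simpa using this.abs
    refine squeeze_zero_norm (fun i => ?_) h1
    exact (norm_indicator_le_norm_self _ _).trans (by rw [Real.norm_eq_abs])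

theorem eventually_abs_integral_inner_noise_sq_sub_le {K t : ℝ} (hJ : CostConditions J wo ν δ)
    (h0 : MemLp A.init 2 P)
    (hN : A.NoiseConditions P J wo β σs Rs) (hS : A.StepConditions P μub μbar σμ)
    (hL : A.CovLipschitzAt P J wo τ₂ κ r) (hr : 0 < r) (hτ₂ : 0 ≤ τ₂)
    (hκ : κ ∈ Set.Icc (1 : ℝ) 2) (hu : ‖u‖ = 1) (ht : 0 < t) (ht1 : t ≤ 1)
    (hK : ∀ᶠ i in atTop, ∫ ω, ‖A.err wo i ω‖ ^ 2 ∂P ≤ K * t ^ 2) :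
    ∀ᶠ i in atTop, |∫ ω, ⟪u, A.noise J i (A.iter i ω) ω⟫ ^ 2 ∂P - u.ofLp ⬝ᵥ Rs.mulVec u.ofLp|
      ≤ (τ₂ * ((1 + r) * (K + 1)) + 1 + β ^ 2 * K
          + (σs ^ 2 + |u.ofLp ⬝ᵥ Rs.mulVec u.ofLp|) * (K / r ^ 2)) * t := by
  have hz := (tendsto_integral_quadForm_minimizer hJ h0 hN hS hL hr hτ₂ hκ hu).abs
  rw [abs_zero] at hz
  -- The convergence to `Rs` has no rate, so it is only asked to be within `t`; this is the summand
  -- `1` in the constant.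
  filter_upwards [hK, hz.eventually_lt_const ht] with i hKi hzi
  set L := u.ofLp ⬝ᵥ Rs.mulVec u.ofLp with hLdef
  set S := {ω | ‖A.err wo i ω‖ ≤ r} with hSdef
  have hmS' : MeasurableSet[A.past i] S := A.measurableSet_near wo r i
  have hmS := A.past_le i _ hmS'
  have hs := (stochStep hJ h0 hN hS i).memLp_s
  have hs' := memLp_noise_truncDisp hJ h0 hN hS r i
  have he := memLp_err hJ h0 hN hS i
  have hei := he.integrable_norm_pow two_ne_zero
  have he0 : 0 ≤ ∫ ω, ‖A.err wo i ω‖ ^ 2 ∂P := integral_nonneg fun ω => sq_nonneg _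
  have hsi := integrable_inner_sq hs u
  set f0 : Ω → ℝ := fun ω => u.ofLp ⬝ᵥ (A.condCov P J i (fun _ => wo) ω).mulVec u.ofLp
    with hf0
  set f1 : Ω → ℝ := fun ω =>
    u.ofLp ⬝ᵥ (A.condCov P J i (fun ω' => wo + A.truncDisp wo r i ω') ω).mulVec u.ofLp with hf1
  have hq1 := A.condCov_quadForm P J u i hs'
  have hq0 := A.condCov_quadForm P J u i (hN.memLp_minimizer i)
  have hf1i : Integrable f1 P := integrable_condExp.congr hq1.symm
  have hf0i : Integrable f0 P := integrable_condExp.congr hq0.symm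
  have k1 : ∫ ω in S, ⟪u, A.noise J i (A.iter i ω) ω⟫ ^ 2 ∂P = ∫ ω in S, f1 ω ∂P := by
    calc _ = ∫ ω in S, ⟪u, A.noise J i (wo + A.truncDisp wo r i ω) ω⟫ ^ 2 ∂P := by
          refine setIntegral_congr_fun hmS fun ω hω => ?_
          rw [A.noise_truncDisp J hω]
      _ = ∫ ω in S, P[fun ω => ⟪u, A.noise J i (wo + A.truncDisp wo r i ω) ω⟫ ^ 2 | A.past i] ω ∂P :=
          (setIntegral_condExp (A.past_le i) (integrable_inner_sq hs' u) hmS').symm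
      _ = _ := integral_congr_ae (ae_restrict_of_ae hq1.symm)
  have k2 : |∫ ω in S, f1 ω ∂P - ∫ ω in S, f0 ω ∂P| ≤ τ₂ * ((1 + r) * (K + 1)) * t := by
    rw [← integral_sub hf1i.integrableOn hf0i.integrableOn]
    have hbi : Integrable (fun ω => τ₂ * ((1 + r) * (‖A.err wo i ω‖ ^ 2 / t + t))) P :=
      (((hei.div_const t).add (integrable_const t)).const_mul (1 + r)).const_mul τ₂
    have hbd := norm_integral_le_of_norm_le (f := fun ω => f1 ω - f0 ω) hbi.integrableOn
      (μ := P.restrict S) (by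
        filter_upwards [ae_restrict_of_ae (hL.abs_quadForm_sub_le hu i
          (A.measurable_truncDisp wo r i) (A.norm_truncDisp_le wo hr i) hs'),
          ae_restrict_mem hmS] with ω e1 e2
        rw [Real.norm_eq_abs]
        refine e1.trans (mul_le_mul_of_nonneg_left ?_ hτ₂)
        refine (rpow_le_of_le (norm_nonneg _) (A.norm_truncDisp_le wo hr i ω) hκ).trans ?_
        gcongr
        rw [truncDisp, Set.indicator_of_mem e2, norm_neg]
        -- `x ≤ x² / t + t` bounds the first moment by `O(t)` when the second is `O(t²)`.
        have e3 : ‖A.err wo i ω‖ ^ 2 / t + t - ‖A.err wo i ω‖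
            = ((‖A.err wo i ω‖ - t / 2) ^ 2 + 3 / 4 * t ^ 2) / t := by
          field_simp; ring
        have e4 : 0 ≤ ((‖A.err wo i ω‖ - t / 2) ^ 2 + 3 / 4 * t ^ 2) / t := by positivity
        linarith)
    rw [Real.norm_eq_abs] at hbd
    refine hbd.trans ((setIntegral_le_integral hbi (ae_of_all _ fun ω => by
      change 0 ≤ τ₂ * ((1 + r) * (‖A.err wo i ω‖ ^ 2 / t + t)); positivity)).trans ?_)
    rw [integral_const_mul, integral_const_mul,
      integral_add (hei.div_const t) (integrable_const t), integral_div]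
    simp only [integral_const, probReal_univ, one_smul]
    have e5 : (∫ ω, ‖A.err wo i ω‖ ^ 2 ∂P) / t ≤ K * t := by
      rw [div_le_iff₀ ht]; linarith
    calc τ₂ * ((1 + r) * ((∫ ω, ‖A.err wo i ω‖ ^ 2 ∂P) / t + t))
        ≤ τ₂ * ((1 + r) * (K * t + t)) := by gcongr
      _ = _ := by ring
  have k3 : ∫ ω, S.indicator (fun ω => f0 ω - L) ω ∂P = ∫ ω in S, f0 ω ∂P - P.real S * L := by
    rw [integral_indicator hmS, integral_sub hf0i.integrableOn (integrable_const _),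
      setIntegral_const, smul_eq_mul]
  have hKr : P.real Sᶜ ≤ K / r ^ 2 * t := by
    have h1 : r ^ 2 * P.real {ω | r ^ 2 ≤ ‖A.err wo i ω‖ ^ 2} ≤ ∫ ω, ‖A.err wo i ω‖ ^ 2 ∂P :=
      mul_meas_ge_le_integral_of_nonneg (ae_of_all _ fun ω => sq_nonneg _) hei _
    have h2 : P.real Sᶜ ≤ P.real {ω | r ^ 2 ≤ ‖A.err wo i ω‖ ^ 2} := by
      refine measureReal_mono fun ω hω => ?_
      have hω' : r < ‖A.err wo i ω‖ := by simpa [hSdef] using hω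
      exact pow_le_pow_left₀ hr.le hω'.le 2
    have h3 : r ^ 2 * P.real Sᶜ ≤ K * t ^ 2 :=
      (mul_le_mul_of_nonneg_left h2 (sq_nonneg r)).trans (h1.trans hKi)
    have hK0 : 0 ≤ K := by
      have := he0.trans hKi
      exact nonneg_of_mul_nonneg_left this (by positivity)
    have h4 : P.real Sᶜ ≤ K * t ^ 2 / r ^ 2 := by
      rw [le_div_iff₀ (by positivity)]; linarith
    calc _ ≤ _ := h4
      _ = K / r ^ 2 * (t * t) := by ring
      _ ≤ K / r ^ 2 * (t * 1) := by gcongr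
      _ = _ := by ring
  have k4 : |∫ ω in Sᶜ, ⟪u, A.noise J i (A.iter i ω) ω⟫ ^ 2 ∂P|
      ≤ β ^ 2 * K * t + σs ^ 2 * (K / r ^ 2 * t) := by
    rw [abs_of_nonneg (integral_nonneg fun ω => sq_nonneg _)]
    obtain ⟨n1, n2⟩ := noise_moment hJ hN i he hmS'.compl
    have h1 : ∫ ω in Sᶜ, ‖A.err wo i ω‖ ^ 2 ∂P ≤ K * t := by
      refine (setIntegral_le_integral hei (ae_of_all _ fun ω => sq_nonneg _)).trans
        (hKi.trans ?_)
      have hK0 : 0 ≤ K := by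
        have := he0.trans hKi
        exact nonneg_of_mul_nonneg_left this (by positivity)
      calc K * t ^ 2 = K * (t * t) := by ring
        _ ≤ K * (t * 1) := by gcongr
        _ = _ := by ring
    have h2 : ∫ ω in Sᶜ, ⟪u, A.noise J i (A.iter i ω) ω⟫ ^ 2 ∂P
        ≤ ∫ ω in Sᶜ, ‖A.noise J i (A.iter i ω) ω‖ ^ 2 ∂P :=
      integral_mono hsi.integrableOn n1 fun ω => inner_sq_le hu _
    have h3 := mul_le_mul_of_nonneg_left h1 (sq_nonneg β)
    have h4 := mul_le_mul_of_nonneg_right hKr (sq_nonneg σs)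
    linarith
  have k5 : |P.real Sᶜ * L| ≤ K / r ^ 2 * t * |L| := by
    rw [abs_mul, abs_of_nonneg measureReal_nonneg]
    gcongr
  have k6 : P.real S + P.real Sᶜ = 1 := by
    rw [measureReal_add_measureReal_compl hmS, probReal_univ]
  rw [← integral_add_compl hmS hsi, k1]
  rw [k3] at hzi
  -- Four errors: moving from the iterate to `wo` on `S`, moving from `wo` to the limit on `S`, the
  -- noise off `S`, and the missing mass of the limit off `S`.
  have key : ∫ ω in S, f1 ω ∂P + ∫ ω in Sᶜ, ⟪u, A.noise J i (A.iter i ω) ω⟫ ^ 2 ∂P - L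
      = (∫ ω in S, f1 ω ∂P - ∫ ω in S, f0 ω ∂P) + (∫ ω in S, f0 ω ∂P - P.real S * L)
        + ∫ ω in Sᶜ, ⟪u, A.noise J i (A.iter i ω) ω⟫ ^ 2 ∂P - P.real Sᶜ * L := by
    have : P.real S * L + P.real Sᶜ * L = L := by rw [← add_mul, k6, one_mul]
    linarith
  rw [key]
  refine (abs_sub _ _).trans ?_
  have t1 := abs_add_le ((∫ ω in S, f1 ω ∂P - ∫ ω in S, f0 ω ∂P)
    + (∫ ω in S, f0 ω ∂P - P.real S * L)) (∫ ω in Sᶜ, ⟪u, A.noise J i (A.iter i ω) ω⟫ ^ 2 ∂P)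
  have t2 := abs_add_le (∫ ω in S, f1 ω ∂P - ∫ ω in S, f0 ω ∂P)
    (∫ ω in S, f0 ω ∂P - P.real S * L)
  linarith

end AsyncSGD

/-! ### Spectral decomposition of the Hessian at the minimizer. -/

theorem trace_eq_sum_quadForm {M : ℕ} (X : Matrix (Fin M) (Fin M) ℝ)
    (b : OrthonormalBasis (Fin M) ℝ (EuclideanSpace ℝ (Fin M))) :
    X.trace = ∑ k, (b k).ofLp ⬝ᵥ X.mulVec (b k).ofLp := by
  have h1 := LinearMap.trace_eq_sum_inner (Matrix.toEuclideanCLM (𝕜 := ℝ) X).toLinearMap b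
  have h2 := LinearMap.trace_eq_sum_inner (Matrix.toEuclideanCLM (𝕜 := ℝ) X).toLinearMap
    (EuclideanSpace.basisFun (Fin M) ℝ)
  rw [h1] at h2
  simp only [ContinuousLinearMap.coe_coe, Matrix.inner_toEuclideanCLM] at h2
  rw [h2]
  simp [Matrix.trace]

namespace CostConditions

variable {M : ℕ} {J : EuclideanSpace ℝ (Fin M) → ℝ} {wo : EuclideanSpace ℝ (Fin M)} {ν δ : ℝ}

theorem exists_eigenbasis (h : CostConditions J wo ν δ) :
    ∃ (b : OrthonormalBasis (Fin M) ℝ (EuclideanSpace ℝ (Fin M))) (lam : Fin M → ℝ),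
      (∀ k, fderiv ℝ (gradient J) wo (b k) = lam k • b k) ∧ ∀ k, ν ≤ lam k ∧ lam k ≤ δ := by
  have hH := h.isHermitian wo
  have he : ∀ k, fderiv ℝ (gradient J) wo (hH.eigenvectorBasis k)
      = hH.eigenvalues k • hH.eigenvectorBasis k := by
    intro k
    rw [← toEuclideanCLM_hessianMatrix]
    ext1 j
    have := congrFun (hH.mulVec_eigenvectorBasis k) j
    simpa using this
  refine ⟨hH.eigenvectorBasis, hH.eigenvalues, he, fun k => ?_⟩
  have h1 := h.lower_inner wo (hH.eigenvectorBasis k)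
  have h2 := h.upper_inner wo (hH.eigenvectorBasis k)
  rw [he k, real_inner_smul_right, real_inner_self_eq_norm_sq,
    hH.eigenvectorBasis.norm_eq_one] at h1 h2
  constructor <;> linarith

theorem trace_inv_mul (h : CostConditions J wo ν δ) (Rs : Matrix (Fin M) (Fin M) ℝ)
    {b : OrthonormalBasis (Fin M) ℝ (EuclideanSpace ℝ (Fin M))} {lam : Fin M → ℝ}
    (hb : ∀ k, fderiv ℝ (gradient J) wo (b k) = lam k • b k) (hlam : ∀ k, ν ≤ lam k) :
    ((hessianMatrix J wo)⁻¹ * Rs).trace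
      = ∑ k, (b k).ofLp ⬝ᵥ Rs.mulVec (b k).ofLp / lam k := by
  have hpd : (hessianMatrix J wo).PosDef := by
    have h1 : (ν • (1 : Matrix (Fin M) (Fin M) ℝ)).PosDef := Matrix.PosDef.one.smul h.pos
    simpa using Matrix.PosDef.posSemidef_add (h.lower wo) h1
  have hu : IsUnit (hessianMatrix J wo).det := (Matrix.isUnit_iff_isUnit_det _).mp hpd.isUnit
  rw [Matrix.trace_mul_comm, trace_eq_sum_quadForm _ b]
  refine Finset.sum_congr rfl fun k _ => ?_
  have hl : lam k ≠ 0 := (h.pos.trans_le (hlam k)).ne'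
  have h1 : (hessianMatrix J wo).mulVec (b k).ofLp = lam k • (b k).ofLp := by
    have := hb k
    rw [← toEuclideanCLM_hessianMatrix] at this
    exact congrArg (fun x : EuclideanSpace ℝ (Fin M) => x.ofLp) this
  have h2 : (hessianMatrix J wo)⁻¹.mulVec (b k).ofLp = (lam k)⁻¹ • (b k).ofLp := by
    have h3 : (b k).ofLp = (lam k)⁻¹ • (hessianMatrix J wo).mulVec (b k).ofLp := by
      rw [h1, smul_smul, inv_mul_cancel₀ hl, one_smul]
    conv_lhs => rw [h3]
    rw [Matrix.mulVec_smul, Matrix.mulVec_mulVec, Matrix.nonsing_inv_mul _ hu, Matrix.one_mulVec]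
  rw [← Matrix.mulVec_mulVec, h2, Matrix.mulVec_smul, dotProduct_smul, smul_eq_mul]
  field_simp

end CostConditions

/-! ### Error recursion along eigenvectors and reassembly of both performance measures. -/

namespace AsyncSGD

variable {Ω : Type*} [m : MeasurableSpace Ω] {M : ℕ} {A : AsyncSGD Ω M}
  {P : Measure Ω} [IsProbabilityMeasure P] {J : EuclideanSpace ℝ (Fin M) → ℝ}
  {wo u : EuclideanSpace ℝ (Fin M)} {ν δ β σs μub μbar σμ τ₂ κ r : ℝ}
  {Rs : Matrix (Fin M) (Fin M) ℝ}

theorem gradient_iter_eq (A : AsyncSGD Ω M) (J : EuclideanSpace ℝ (Fin M) → ℝ)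
    (wo : EuclideanSpace ℝ (Fin M)) (i : ℕ) (ω : Ω) :
    gradient J (A.iter i ω)
      = -(fderiv ℝ (gradient J) wo (A.err wo i ω)) + gradRem J wo (A.iter i ω) := by
  have h : A.iter i ω - wo = -A.err wo i ω := by simp [err]
  rw [gradRem, h, map_neg]
  abel

theorem measurable_gradRem_iter (A : AsyncSGD Ω M) (hJ : CostConditions J wo ν δ) (i : ℕ) :
    Measurable fun ω => gradRem J wo (A.iter i ω) := by
  have hc : Continuous (gradRem J wo) := by
    have := hJ.differentiable_gradient.continuous
    unfold gradRem
    fun_prop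
  exact hc.measurable.comp (A.measurable_iter i)

theorem norm_gradRem_iter_le (hJ : CostConditions J wo ν δ) (i : ℕ) (ω : Ω) :
    ‖gradRem J wo (A.iter i ω)‖ ≤ 2 * δ * ‖A.err wo i ω‖ := by
  rw [err, norm_sub_rev]
  exact hJ.norm_gradRem_le_linear _

/-- The recursion for the second moment of the error along an eigenvector of the Hessian. -/
theorem integral_inner_err_sq_succ (hJ : CostConditions J wo ν δ) (h0 : MemLp A.init 2 P)
    (hN : A.NoiseConditions P J wo β σs Rs) (hS : A.StepConditions P μub μbar σμ) {lam : ℝ}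
    (hlam : fderiv ℝ (gradient J) wo u = lam • u) (i : ℕ) :
    ∫ ω, ⟪u, A.err wo (i + 1) ω⟫ ^ 2 ∂P
      = (1 - 2 * lam * μbar) * ∫ ω, ⟪u, A.err wo i ω⟫ ^ 2 ∂P
        + 2 * μbar * ∫ ω, ⟪u, A.err wo i ω⟫ * ⟪u, gradRem J wo (A.iter i ω)⟫ ∂P
        + μbar * muX μbar σμ * (∫ ω, ⟪u, gradient J (A.iter i ω)⟫ ^ 2 ∂P
          + ∫ ω, ⟪u, A.noise J i (A.iter i ω) ω⟫ ^ 2 ∂P) := by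
  have hst := stochStep hJ h0 hN hS i
  have h := (hst.comp (innerSL ℝ u)).integral_norm_sq_update
  have hrem : MemLp (fun ω => gradRem J wo (A.iter i ω)) 2 P :=
    hst.memLp_e.of_le_mul (A.measurable_gradRem_iter hJ i).aestronglyMeasurable
      (ae_of_all _ fun ω => norm_gradRem_iter_le hJ i ω)
  have i1 := integrable_inner_sq hst.memLp_e u
  have i2 : Integrable (fun ω => ⟪u, A.err wo i ω⟫ * ⟪u, gradRem J wo (A.iter i ω)⟫) P :=
    ((innerSL ℝ u).comp_memLp' hst.memLp_e).integrable_mul ((innerSL ℝ u).comp_memLp' hrem)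
  have e1 : ∀ ω, ⟪u, A.err wo i ω⟫ * ⟪u, gradient J (A.iter i ω)⟫
      = -lam * ⟪u, A.err wo i ω⟫ ^ 2
        + ⟪u, A.err wo i ω⟫ * ⟪u, gradRem J wo (A.iter i ω)⟫ := by
    intro ω
    rw [A.gradient_iter_eq J wo, inner_add_right, inner_neg_right, ← hJ.isSymmetric, hlam,
      real_inner_smul_left]
    ring
  have e2 : ∫ ω, ⟪u, A.err wo i ω⟫ * ⟪u, gradient J (A.iter i ω)⟫ ∂P
      = -lam * ∫ ω, ⟪u, A.err wo i ω⟫ ^ 2 ∂P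
        + ∫ ω, ⟪u, A.err wo i ω⟫ * ⟪u, gradRem J wo (A.iter i ω)⟫ ∂P := by
    simp_rw [e1]
    rw [integral_add (i1.const_mul _) i2, integral_const_mul]
  have e3 : ∀ ω, ⟪⟪u, A.err wo i ω⟫, ⟪u, gradient J (A.iter i ω)⟫⟫
      = ⟪u, A.err wo i ω⟫ * ⟪u, gradient J (A.iter i ω)⟫ := fun ω => by
    simp [mul_comm]
  have e4 : ∀ ω, ⟪u, A.err wo (i + 1) ω⟫ = ⟪u, A.err wo i ω⟫ + A.step i ω •
      (⟪u, gradient J (A.iter i ω)⟫ + ⟪u, A.noise J i (A.iter i ω) ω⟫) := fun ω => by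
    rw [A.err_succ J wo, inner_add_right, real_inner_smul_right, inner_add_right, smul_eq_mul]
  simp_rw [e4]
  simp only [innerSL_apply_apply, Real.norm_eq_abs, sq_abs] at h
  simp_rw [e3] at h
  rw [h, e2, hS.mean i, integral_step_sq hS i, mul_muX hS.mean_pos]
  ring

theorem eventually_abs_integral_inner_err_sq_sub_le {K C₃ t lam : ℝ}
    (hJ : CostConditions J wo ν δ) (h0 : MemLp A.init 2 P)
    (hN : A.NoiseConditions P J wo β σs Rs) (hS : A.StepConditions P μub μbar σμ)
    (hL : A.CovLipschitzAt P J wo τ₂ κ r) (hr : 0 < r) (hτ₂ : 0 ≤ τ₂)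
    (hκ : κ ∈ Set.Icc (1 : ℝ) 2) (hu : ‖u‖ = 1)
    (hT : fderiv ℝ (gradient J) wo u = lam • u) (hlam : ν ≤ lam ∧ lam ≤ δ)
    (ht : 0 < t) (ht1 : t ≤ 1) (htμ : muX μbar σμ = t ^ 2) (htδ : 2 * δ * t ^ 2 ≤ 1)
    (hK : ∀ᶠ i in atTop, ∫ ω, ‖A.err wo i ω‖ ^ 2 ∂P ≤ K * t ^ 2)
    (hC₃ : ∀ᶠ i in atTop,
      ∫ ω, ‖A.err wo i ω‖ * ‖gradRem J wo (A.iter i ω)‖ ∂P ≤ C₃ * t ^ 3) :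
    ∀ᶠ i in atTop, |∫ ω, ⟪u, A.err wo i ω⟫ ^ 2 ∂P
        - t ^ 2 * (u.ofLp ⬝ᵥ Rs.mulVec u.ofLp) / (2 * lam)|
      ≤ ((2 * C₃ + δ ^ 2 * K + (τ₂ * ((1 + r) * (K + 1)) + 1 + β ^ 2 * K
          + (σs ^ 2 + |u.ofLp ⬝ᵥ Rs.mulVec u.ofLp|) * (K / r ^ 2))) / ν + 1) * t ^ 3 := by
  have hν := hJ.pos
  have hδ := hJ.pos_upper
  have hb := hS.mean_pos
  have hl0 : 0 < lam := hν.trans_le hlam.1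
  have hbt : μbar ≤ t ^ 2 := htμ ▸ le_muX hb
  set L := u.ofLp ⬝ᵥ Rs.mulVec u.ofLp
  set Cn := τ₂ * ((1 + r) * (K + 1)) + 1 + β ^ 2 * K + (σs ^ 2 + |L|) * (K / r ^ 2)
  have hnoise := eventually_abs_integral_inner_noise_sq_sub_le hJ h0 hN hS hL hr hτ₂ hκ hu ht ht1 hK
  have hK0 : 0 ≤ K := by
    obtain ⟨i, hi⟩ := hK.exists
    have h1 : 0 ≤ ∫ ω, ‖A.err wo i ω‖ ^ 2 ∂P := integral_nonneg fun ω => sq_nonneg _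
    exact nonneg_of_mul_nonneg_left (h1.trans hi) (by positivity)
  have hC0 : 0 ≤ C₃ := by
    obtain ⟨i, hi⟩ := hC₃.exists
    have h1 : 0 ≤ ∫ ω, ‖A.err wo i ω‖ * ‖gradRem J wo (A.iter i ω)‖ ∂P :=
      integral_nonneg fun ω => by positivity
    exact nonneg_of_mul_nonneg_left (h1.trans hi) (by positivity)
  have hCn0 : 0 ≤ Cn := by positivity
  -- Centring at the fixed point cancels `μbar t² L` from the driving term. What is left in `e` has
  -- the common factor `μbar`, which cancels against the rate `a`.
  refine eventually_abs_sub_le_of_contraction (a := 2 * lam * μbar)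
    (b := μbar * ((2 * C₃ + δ ^ 2 * K + Cn) * t ^ 3))
    (e := fun i => μbar * (2 * (∫ ω, ⟪u, A.err wo i ω⟫ * ⟪u, gradRem J wo (A.iter i ω)⟫ ∂P)
      + t ^ 2 * (∫ ω, ⟪u, gradient J (A.iter i ω)⟫ ^ 2 ∂P)
      + t ^ 2 * (∫ ω, ⟪u, A.noise J i (A.iter i ω) ω⟫ ^ 2 ∂P - L)))
    (by positivity) ?_ ?_ (Eventually.of_forall fun i => ?_) ?_
  · calc 2 * lam * μbar ≤ 2 * δ * t ^ 2 := by gcongr; exact hlam.2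
      _ ≤ 1 := htδ
  · have h1 : μbar * ((2 * C₃ + δ ^ 2 * K + Cn) * t ^ 3) / (2 * lam * μbar)
        = (2 * C₃ + δ ^ 2 * K + Cn) / (2 * lam) * t ^ 3 := by field_simp
    rw [h1]
    have h2 : (2 * C₃ + δ ^ 2 * K + Cn) / (2 * lam) ≤ (2 * C₃ + δ ^ 2 * K + Cn) / ν := by
      gcongr
      linarith [hlam.1]
    have h3 := pow_pos ht 3
    nlinarith
  · rw [integral_inner_err_sq_succ hJ h0 hN hS hT i, htμ]
    field_simp
    ring
  · filter_upwards [hK, hC₃, hnoise] with i k1 k2 k3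
    have hst := stochStep hJ h0 hN hS i
    have hrem : MemLp (fun ω => gradRem J wo (A.iter i ω)) 2 P :=
      hst.memLp_e.of_le_mul (A.measurable_gradRem_iter hJ i).aestronglyMeasurable
        (ae_of_all _ fun ω => norm_gradRem_iter_le hJ i ω)
    have j1 : |∫ ω, ⟪u, A.err wo i ω⟫ * ⟪u, gradRem J wo (A.iter i ω)⟫ ∂P| ≤ C₃ * t ^ 3 := by
      have hi : Integrable (fun ω => ‖A.err wo i ω‖ * ‖gradRem J wo (A.iter i ω)‖) P :=
        hst.memLp_e.norm.integrable_mul hrem.norm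
      refine le_trans ?_ k2
      rw [← Real.norm_eq_abs]
      refine norm_integral_le_of_norm_le hi (ae_of_all _ fun ω => ?_)
      rw [norm_mul]
      have a1 := norm_inner_le_norm (𝕜 := ℝ) u (A.err wo i ω)
      have a2 := norm_inner_le_norm (𝕜 := ℝ) u (gradRem J wo (A.iter i ω))
      rw [hu, one_mul] at a1 a2
      gcongr
    have j2 : |∫ ω, ⟪u, gradient J (A.iter i ω)⟫ ^ 2 ∂P| ≤ δ ^ 2 * K * t := by
      rw [abs_of_nonneg (integral_nonneg fun ω => sq_nonneg _)]
      calc _ ≤ ∫ ω, δ ^ 2 * ‖A.err wo i ω‖ ^ 2 ∂P := by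
            refine integral_mono (integrable_inner_sq hst.memLp_q u)
              ((hst.memLp_e.integrable_norm_pow two_ne_zero).const_mul _) fun ω => ?_
            refine (inner_sq_le hu _).trans ?_
            simp only [← mul_pow]
            exact pow_le_pow_left₀ (norm_nonneg _) (norm_gradient_iter_le hJ i ω) 2
        _ = δ ^ 2 * ∫ ω, ‖A.err wo i ω‖ ^ 2 ∂P := integral_const_mul _ _
        _ ≤ δ ^ 2 * (K * t ^ 2) := by gcongr
        _ = δ ^ 2 * K * (t * t) := by ring
        _ ≤ δ ^ 2 * K * (t * 1) := by gcongr
        _ = _ := by ring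
    rw [abs_mul, abs_of_pos hb]
    gcongr
    refine (abs_add_three _ _ _).trans ?_
    rw [abs_mul, abs_mul, abs_mul, abs_two, abs_of_nonneg (sq_nonneg t)]
    have j3 := mul_le_mul_of_nonneg_left j2 (sq_nonneg t)
    have j4 := mul_le_mul_of_nonneg_left k3 (sq_nonneg t)
    linarith

theorem integral_norm_err_sq_eq_sum (hJ : CostConditions J wo ν δ) (h0 : MemLp A.init 2 P)
    (hN : A.NoiseConditions P J wo β σs Rs) (hS : A.StepConditions P μub μbar σμ)
    (b : OrthonormalBasis (Fin M) ℝ (EuclideanSpace ℝ (Fin M))) (i : ℕ) :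
    ∫ ω, ‖A.err wo i ω‖ ^ 2 ∂P = ∑ k, ∫ ω, ⟪b k, A.err wo i ω⟫ ^ 2 ∂P := by
  rw [← integral_finsetSum _ fun k _ => integrable_inner_sq (memLp_err hJ h0 hN hS i) (b k)]
  congr 1 with ω
  rw [← b.sum_sq_norm_inner_right]
  simp

theorem integrable_cost (hJ : CostConditions J wo ν δ) (h0 : MemLp A.init 2 P)
    (hN : A.NoiseConditions P J wo β σs Rs) (hS : A.StepConditions P μub μbar σμ) (i : ℕ) :
    Integrable (fun ω => J (A.iter i ω) - J wo) P := by
  refine (((memLp_err hJ h0 hN hS i).integrable_norm_pow two_ne_zero).const_mul δ).mono'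
    ((hJ.differentiable.continuous.measurable.comp
      (A.measurable_iter i)).sub_const _).aestronglyMeasurable (ae_of_all _ fun ω => ?_)
  have h := hJ.sub_le (A.iter i ω)
  rw [norm_sub_rev] at h
  exact h

theorem integral_cost_eq_sum (hJ : CostConditions J wo ν δ) (h0 : MemLp A.init 2 P)
    (hN : A.NoiseConditions P J wo β σs Rs) (hS : A.StepConditions P μub μbar σμ)
    {b : OrthonormalBasis (Fin M) ℝ (EuclideanSpace ℝ (Fin M))} {lam : Fin M → ℝ}
    (hb : ∀ k, fderiv ℝ (gradient J) wo (b k) = lam k • b k) (i : ℕ) :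
    ∫ ω, (J (A.iter i ω) - J wo) ∂P
      = ∑ k, lam k / 2 * ∫ ω, ⟪b k, A.err wo i ω⟫ ^ 2 ∂P
        + ∫ ω, costRem J wo (A.iter i ω) ∂P := by
  have hq : ∀ k, Integrable (fun ω => lam k / 2 * ⟪b k, A.err wo i ω⟫ ^ 2) P := fun k =>
    (integrable_inner_sq (memLp_err hJ h0 hN hS i) (b k)).const_mul _
  have hsum : Integrable (fun ω => ∑ k, lam k / 2 * ⟪b k, A.err wo i ω⟫ ^ 2) P :=
    integrable_finsetSum _ fun k _ => hq k
  have h1 : ∀ ω, costRem J wo (A.iter i ω)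
      = (J (A.iter i ω) - J wo) - ∑ k, lam k / 2 * ⟪b k, A.err wo i ω⟫ ^ 2 := by
    intro ω
    have h2 : A.iter i ω - wo = -A.err wo i ω := by simp [err]
    rw [costRem, h2, map_neg, inner_neg_neg, ← b.sum_inner_mul_inner, Finset.mul_sum]
    congr 1
    refine Finset.sum_congr rfl fun k _ => ?_
    rw [← hJ.isSymmetric, hb, real_inner_smul_left, real_inner_comm]
    ring
  simp_rw [h1]
  rw [integral_sub (integrable_cost hJ h0 hN hS i) hsum, integral_finsetSum _ fun k _ => hq k]
  simp_rw [integral_const_mul]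
  ring

/-- A linear combination of approximated quantities is approximated. -/
theorem _root_.eventually_abs_sum_sub_le {ι : Type*} [Fintype ι] {x : ι → ℕ → ℝ} {w l D : ι → ℝ}
    {c : ℝ} (h : ∀ k, ∀ᶠ i in atTop, |x k i - l k| ≤ D k * c) (hw : ∀ k, 0 ≤ w k) :
    ∀ᶠ i in atTop, |∑ k, w k * x k i - ∑ k, w k * l k| ≤ (∑ k, w k * D k) * c := by
  filter_upwards [eventually_all.mpr h] with i hi
  rw [← Finset.sum_sub_distrib, Finset.sum_mul]
  refine (Finset.abs_sum_le_sum_abs _ _).trans (Finset.sum_le_sum fun k _ => ?_)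
  rw [← mul_sub, abs_mul, abs_of_nonneg (hw k), mul_assoc]
  exact mul_le_mul_of_nonneg_left (hi k) (hw k)

end AsyncSGD

/-! ### The convergence rate and the size of the Taylor remainders. -/

namespace AsyncSGD

theorem alphaAsyn_bounds {ν δ β μbar σμ : ℝ} (hν : 0 < ν) (hle : ν ≤ δ) (hμ : 0 < μbar)
    (h : muX μbar σμ < 2 * ν / (δ ^ 2 + β ^ 2)) :
    0 ≤ alphaAsyn ν δ β μbar σμ ∧ alphaAsyn ν δ β μbar σμ < 1 ∧
      |alphaAsyn ν δ β μbar σμ - (1 - 2 * ν * μbar)|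
        ≤ (δ ^ 2 + β ^ 2) * muX μbar σμ ^ 2 := by
  have hx := muX_pos (σμ := σμ) hμ
  have hd : 0 < δ ^ 2 + β ^ 2 := by have := hν.trans_le hle; positivity
  have hm := mul_muX (σμ := σμ) hμ
  refine ⟨?_, ?_, ?_⟩
  · have h1 : ν ^ 2 ≤ δ ^ 2 + β ^ 2 := by nlinarith [sq_nonneg β]
    have h2 : ν ^ 2 * μbar ^ 2 ≤ (δ ^ 2 + β ^ 2) * (μbar ^ 2 + σμ ^ 2) := by
      gcongr
      linarith [sq_nonneg σμ]
    unfold alphaAsyn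
    nlinarith [sq_nonneg (1 - ν * μbar)]
  · rw [lt_div_iff₀ hd] at h
    unfold alphaAsyn
    rw [← hm]
    have := mul_lt_mul_of_pos_left h hμ
    linarith
  · have h1 : alphaAsyn ν δ β μbar σμ - (1 - 2 * ν * μbar)
        = (δ ^ 2 + β ^ 2) * (μbar * muX μbar σμ) := by
      unfold alphaAsyn; rw [hm]; ring
    rw [h1, abs_of_nonneg (by positivity), sq (muX μbar σμ)]
    gcongr
    exact le_muX hμ

variable {Ω : Type*} [m : MeasurableSpace Ω] {M : ℕ} {A : AsyncSGD Ω M}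
  {P : Measure Ω} [IsProbabilityMeasure P] {J : EuclideanSpace ℝ (Fin M) → ℝ}
  {wo : EuclideanSpace ℝ (Fin M)} {ν δ β σs μub μbar σμ τ r : ℝ}
  {Rs : Matrix (Fin M) (Fin M) ℝ}

/-- Both remainders are of order `t ^ 3` in the mean, where `t ^ 2` is the step-size parameter. -/
theorem eventually_remainders_le {β₄ σ₄ ρ t : ℝ} (hJ : CostConditions J wo ν δ)
    (hr : 0 < r) (hτ : 0 ≤ τ) (hH : HessianLipschitzAt J wo τ r) (h0 : MemLp A.init 2 P)
    (hN : A.NoiseConditions P J wo β σs Rs) (hS : A.StepConditions P μub μbar σμ)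
    (h4 : (∀ w, hessianMatrix J w = hessianMatrix J wo) ∨
      A.FourthMomentConditions P J wo β₄ σ₄ ρ μbar σμ)
    (hμ : muX μbar σμ * (δ ^ 2 + β ^ 2) ≤ ν)
    (hμ4 : muX μbar σμ ^ 2 * (8 * (16 / ν + 3 * |ρ|) * (δ ^ 4 + β₄ ^ 4)) ≤ ν)
    (ht : 0 < t) (htμ : muX μbar σμ = t ^ 2) :
    (∀ᶠ i in atTop, ∫ ω, ‖A.err wo i ω‖ * ‖gradRem J wo (A.iter i ω)‖ ∂P
      ≤ (τ + 2 * δ / r + 2 * δ) * ((8 * (16 / ν + 3 * |ρ|) * σ₄ ^ 4 / ν + 1)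
        + 2 * (σs ^ 2 / ν + 1)) * t ^ 3) ∧
    (∀ᶠ i in atTop, |∫ ω, costRem J wo (A.iter i ω) ∂P|
      ≤ (τ + 2 * δ / r + 2 * δ) * ((8 * (16 / ν + 3 * |ρ|) * σ₄ ^ 4 / ν + 1)
        + 2 * (σs ^ 2 / ν + 1)) * t ^ 3) := by
  have hν := hJ.pos
  have hδ := hJ.pos_upper
  rcases h4 with hc | h4
  · constructor <;> refine Eventually.of_forall fun i => ?_
    · simp only [hJ.gradRem_eq_zero hc, norm_zero, mul_zero, integral_zero]
      positivity
    · simp only [hJ.costRem_eq_zero hc, integral_zero, abs_zero]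
      positivity
  set κJ := τ + 2 * δ / r + 2 * δ with hκJ
  have hκ0 : 0 ≤ κJ := by positivity
  have hmin := eventually_integral_min_err_le hJ h0 hN hS h4 hμ hμ4 ht htμ
  have hmi : ∀ i, Integrable (fun ω => κJ * min (‖A.err wo i ω‖ ^ 2) (‖A.err wo i ω‖ ^ 3)) P := by
    intro i
    refine Integrable.const_mul (((memLp_err hJ h0 hN hS i).integrable_norm_pow two_ne_zero).mono'
      (((A.measurable_err wo i).norm.pow_const 2).min
      ((A.measurable_err wo i).norm.pow_const 3)).aestronglyMeasurable (ae_of_all _ fun ω => ?_)) _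
    rw [Real.norm_eq_abs, abs_of_nonneg (by positivity)]
    exact min_le_left _ _
  have hd : ∀ i ω, ‖A.iter i ω - wo‖ = ‖A.err wo i ω‖ := fun i ω => by rw [err, norm_sub_rev]
  constructor
  · filter_upwards [hmin] with i hi
    refine (integral_mono_of_nonneg (ae_of_all _ fun ω => ?_) (hmi i)
      (ae_of_all _ fun ω => ?_)).trans ?_
    · exact mul_nonneg (norm_nonneg _) (norm_nonneg _)
    · have h1 := hJ.norm_gradRem_le_min hr hτ hH (A.iter i ω)
      rw [hd] at h1
      calc ‖A.err wo i ω‖ * ‖gradRem J wo (A.iter i ω)‖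
          ≤ ‖A.err wo i ω‖ * (κJ * min ‖A.err wo i ω‖ (‖A.err wo i ω‖ ^ 2)) := by gcongr
        _ = κJ * (‖A.err wo i ω‖ * min ‖A.err wo i ω‖ (‖A.err wo i ω‖ ^ 2)) := by ring
        _ = _ := by
          rw [mul_min_of_nonneg _ _ (norm_nonneg _)]
          ring_nf
    · rw [integral_const_mul, mul_assoc]
      gcongr
  · filter_upwards [hmin] with i hi
    rw [← Real.norm_eq_abs]
    refine (norm_integral_le_of_norm_le (hmi i) (ae_of_all _ fun ω => ?_)).trans ?_
    · have h1 := hJ.abs_costRem_le_min hr hτ hH (A.iter i ω)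
      rwa [hd] at h1
    · rw [integral_const_mul, mul_assoc]
      gcongr

end AsyncSGD

/-! ### The main theorem. -/

theorem lemma2 {M : ℕ} (J : EuclideanSpace ℝ (Fin M) → ℝ) (wo : EuclideanSpace ℝ (Fin M))
    (ν δ β σs τ τ₂ κ r β₄ σ₄ ρ : ℝ) (Rs : Matrix (Fin M) (Fin M) ℝ)
    (hJ : CostConditions J wo ν δ)
    (hr : 0 < r) (hτ : 0 ≤ τ) (hτ₂ : 0 ≤ τ₂) (hκ : κ ∈ Set.Icc (1 : ℝ) 2)
    (hH : HessianLipschitzAt J wo τ r) :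
    ∃ C μ₁ : ℝ, 0 < C ∧ 0 < μ₁ ∧ μ₁ ≤ 2 * ν / (δ ^ 2 + β ^ 2) ∧
      ∀ {Ω : Type*} [MeasurableSpace Ω] (P : Measure Ω) [IsProbabilityMeasure P]
        (A : AsyncSGD Ω M) (μub μbar σμ : ℝ),
        MemLp A.init 2 P →
        A.NoiseConditions P J wo β σs Rs →
        A.StepConditions P μub μbar σμ →
        A.CovLipschitzAt P J wo τ₂ κ r →
        muX μbar σμ < 2 * ν / (δ ^ 2 + β ^ 2) →
        -- convergence rate
        ((∀ i, Integrable (fun ω => ‖A.err wo i ω‖ ^ 2) P) ∧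
          (∀ i, Integrable (fun ω => J (A.iter i ω) - J wo) P) ∧
          0 ≤ alphaAsyn ν δ β μbar σμ ∧ alphaAsyn ν δ β μbar σμ < 1 ∧
          (∀ i, ∫ ω, ‖A.err wo (i + 1) ω‖ ^ 2 ∂P
            ≤ alphaAsyn ν δ β μbar σμ * ∫ ω, ‖A.err wo i ω‖ ^ 2 ∂P
              + (μbar ^ 2 + σμ ^ 2) * σs ^ 2) ∧
          |alphaAsyn ν δ β μbar σμ - (1 - 2 * ν * μbar)| ≤ C * muX μbar σμ ^ 2) ∧
        -- mean-square deviation and excess risk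
        (muX μbar σμ < μ₁ →
          ((∀ w, hessianMatrix J w = hessianMatrix J wo) ∨
            A.FourthMomentConditions P J wo β₄ σ₄ ρ μbar σμ) →
          |A.msdSup P wo - muX μbar σμ / 2 * ((hessianMatrix J wo)⁻¹ * Rs).trace|
              ≤ C * muX μbar σμ ^ (3 / 2 : ℝ) ∧
          |A.msdInf P wo - muX μbar σμ / 2 * ((hessianMatrix J wo)⁻¹ * Rs).trace|
              ≤ C * muX μbar σμ ^ (3 / 2 : ℝ) ∧
          |A.erSup P J wo - muX μbar σμ / 4 * Rs.trace| ≤ C * muX μbar σμ ^ (3 / 2 : ℝ) ∧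
          |A.erInf P J wo - muX μbar σμ / 4 * Rs.trace| ≤ C * muX μbar σμ ^ (3 / 2 : ℝ)) := by

  have hν := hJ.pos
  have hδ := hJ.pos_upper
  obtain ⟨b, lam, hb, hlam⟩ := hJ.exists_eigenbasis
  set L : Fin M → ℝ := fun k => (b k).ofLp ⬝ᵥ Rs.mulVec (b k).ofLp with hLdef
  set K := σs ^ 2 / ν + 1 with hK
  set C₃ := (τ + 2 * δ / r + 2 * δ) * ((8 * (16 / ν + 3 * |ρ|) * σ₄ ^ 4 / ν + 1)
    + 2 * (σs ^ 2 / ν + 1)) with hC₃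
  set D : Fin M → ℝ := fun k => (2 * C₃ + δ ^ 2 * K + (τ₂ * ((1 + r) * (K + 1)) + 1 + β ^ 2 * K
    + (σs ^ 2 + |L k|) * (K / r ^ 2))) / ν + 1 with hD
  have hK0 : 0 ≤ K := by positivity
  have hC₃0 : 0 ≤ C₃ := by positivity
  have hD0 : ∀ k, 0 ≤ D k := fun k => by positivity
  have hl0 : ∀ k, 0 < lam k := fun k => hν.trans_le (hlam k).1
  set S₁ := ∑ k, 1 * D k with hS₁
  set S₂ := ∑ k, lam k / 2 * D k with hS₂
  have hS₁0 : 0 ≤ S₁ := Finset.sum_nonneg fun k _ => mul_nonneg zero_le_one (hD0 k)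
  have hS₂0 : 0 ≤ S₂ := Finset.sum_nonneg fun k _ => mul_nonneg (half_pos (hl0 k)).le (hD0 k)
  have hd : 0 < δ ^ 2 + β ^ 2 := by positivity
  set Q := 8 * (16 / ν + 3 * |ρ|) * (δ ^ 4 + β₄ ^ 4) with hQ
  have hQ0 : 0 < Q := by positivity
  -- The four thresholds keep the second-moment rate at least `ν μbar`, ensure `2 lam μbar ≤ 1` for
  -- every eigenvalue, give `t ≤ 1`, and, using `muX² ≤ muX`, let the fourth-order perturbation be
  -- absorbed.
  refine ⟨δ ^ 2 + β ^ 2 + S₁ + S₂ + C₃,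
    min (min (ν / (δ ^ 2 + β ^ 2)) (1 / (2 * δ))) (min 1 (ν / Q)), by positivity, by positivity,
    ?_, ?_⟩
  · refine ((min_le_left _ _).trans (min_le_left _ _)).trans ?_
    gcongr
    linarith
  intro Ω _ P _ A μub μbar σμ h0 hN hS hL hμ
  have hμb := hS.mean_pos
  have hx := AsyncSGD.muX_pos (σμ := σμ) hμb
  obtain ⟨a0, a1, a2⟩ := AsyncSGD.alphaAsyn_bounds hν hJ.le hμb hμ
  refine ⟨⟨fun i => (AsyncSGD.memLp_err hJ h0 hN hS i).integrable_norm_pow two_ne_zero,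
    fun i => AsyncSGD.integrable_cost hJ h0 hN hS i, a0, a1, fun i => ?_, ?_⟩, ?_⟩
  · simpa using AsyncSGD.setIntegral_err_sq_succ_le hJ h0 hN hS i (B := Set.univ) MeasurableSet.univ
  · exact a2.trans (mul_le_mul_of_nonneg_right (by linarith) (sq_nonneg _))
  intro hμ₁ h4
  simp only [lt_min_iff] at hμ₁
  obtain ⟨⟨b1, b2⟩, b3, b4⟩ := hμ₁
  rw [lt_div_iff₀ hd] at b1
  rw [lt_div_iff₀ (by positivity)] at b2
  rw [lt_div_iff₀ hQ0] at b4
  set t := Real.sqrt (muX μbar σμ) with ht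
  have ht0 : 0 < t := Real.sqrt_pos.mpr hx
  have htμ : muX μbar σμ = t ^ 2 := (Real.sq_sqrt hx.le).symm
  have ht3 : muX μbar σμ ^ (3 / 2 : ℝ) = t ^ 3 := by
    rw [ht, Real.sqrt_eq_rpow, ← Real.rpow_natCast, ← Real.rpow_mul hx.le]
    norm_num
  have ht1 : t ≤ 1 := by
    nlinarith
  have hμ4 : muX μbar σμ ^ 2 * Q ≤ ν := by
    have : muX μbar σμ ^ 2 ≤ muX μbar σμ := by nlinarith
    calc _ ≤ muX μbar σμ * Q := by gcongr
      _ ≤ ν := b4.le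
  obtain ⟨r1, r2⟩ := AsyncSGD.eventually_remainders_le hJ hr hτ hH h0 hN hS h4 b1.le hμ4 ht0 htμ
  have hmode : ∀ k, ∀ᶠ i in atTop, |∫ ω, inner ℝ (b k) (A.err wo i ω) ^ 2 ∂P
      - t ^ 2 * L k / (2 * lam k)| ≤ D k * t ^ 3 := fun k =>
    AsyncSGD.eventually_abs_integral_inner_err_sq_sub_le hJ h0 hN hS hL hr hτ₂ hκ
      (b.norm_eq_one k) (hb k) (hlam k) ht0 ht1 htμ (by rw [← htμ]; linarith)
      (AsyncSGD.eventually_integral_err_sq_le hJ h0 hN hS b1.le ht0 htμ) r1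
  have t1 : muX μbar σμ / 2 * ((hessianMatrix J wo)⁻¹ * Rs).trace
      = ∑ k, 1 * (t ^ 2 * L k / (2 * lam k)) := by
    rw [hJ.trace_inv_mul Rs hb fun k => (hlam k).1, Finset.mul_sum, htμ]
    refine Finset.sum_congr rfl fun k _ => ?_
    have := (hl0 k).ne'
    field_simp
    rfl
  -- The weight `lam k / 2` of the quadratic model cancels the eigenvalue in the fixed point, so the
  -- Hessian disappears from the excess risk.
  have t2 : muX μbar σμ / 4 * Rs.trace = ∑ k, lam k / 2 * (t ^ 2 * L k / (2 * lam k)) := by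
    rw [trace_eq_sum_quadForm Rs b, Finset.mul_sum, htμ]
    refine Finset.sum_congr rfl fun k _ => ?_
    have := (hl0 k).ne'
    field_simp
    ring
  have ht3p := pow_pos ht0 3
  have e1 : ∀ᶠ i in atTop, |∫ ω, ‖A.err wo i ω‖ ^ 2 ∂P
      - muX μbar σμ / 2 * ((hessianMatrix J wo)⁻¹ * Rs).trace|
      ≤ (δ ^ 2 + β ^ 2 + S₁ + S₂ + C₃) * muX μbar σμ ^ (3 / 2 : ℝ) := by
    filter_upwards [eventually_abs_sum_sub_le (w := fun _ => 1) hmode fun _ => zero_le_one]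
      with i hi
    rw [t1, ht3, AsyncSGD.integral_norm_err_sq_eq_sum hJ h0 hN hS b]
    simp only [one_mul] at hi ⊢
    refine hi.trans ?_
    gcongr
    simp only [hS₁, one_mul]
    linarith
  have e2 : ∀ᶠ i in atTop, |∫ ω, (J (A.iter i ω) - J wo) ∂P - muX μbar σμ / 4 * Rs.trace|
      ≤ (δ ^ 2 + β ^ 2 + S₁ + S₂ + C₃) * muX μbar σμ ^ (3 / 2 : ℝ) := by
    filter_upwards [eventually_abs_sum_sub_le (w := fun k => lam k / 2) hmode
      fun k => (half_pos (hl0 k)).le, r2] with i hi hi2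
    rw [t2, ht3, AsyncSGD.integral_cost_eq_sum hJ h0 hN hS hb, add_sub_right_comm]
    refine (abs_add_le _ _).trans ((add_le_add hi hi2).trans ?_)
    rw [← add_mul]
    gcongr
    linarith
  exact ⟨(abs_limsup_sub_le e1).1, (abs_limsup_sub_le e1).2, (abs_limsup_sub_le e2).1,
    (abs_limsup_sub_le e2).2⟩
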